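/- All vector spaces are real. A map between open subsets of Banach spaces is of class $C^{k,\alpha}_{\rm loc}$ ($k\in\mathbb N_0\cup\{\infty\}$, $\alpha\in[0,1]$) if it is $C^k$ and, when $k<\infty$, its $k$-th derivative is $\alpha$-Hölder continuous near every point. Banach manifolds (charts with values in possibly different Banach spaces) and Banach bundles (transition maps regarded as maps into spaces of bounded operators) of class $C^{k,\alpha}_{\rm loc}$ are understood accordingly, as are maps between such manifolds and bundle morphisms. A *para-Hilbert space* $E$ consists of Banach spaces $X_E$, $Y_E$, a Hilbert space $H_E$ with inner product $\langle\cdot,\cdot\rangle_{H_E}$ and Riesz isomorphism $I_E\colon H_E\to H_E'$, continuous linear injections $i_E\colon X_E\to H_E$ and $j_E\colon H_E\to Y_E$ with dense images, and an isomorphism $J_E\colon X_E\to Y_E'$ of Banach spaces with $I_E\, i_E=j_E'\,J_E$. A *morphism* $A\colon E_1\to E_2$ is a triple $(X_A,H_A,Y_A)$ of bounded operators on the three scales commuting with $i$ and $j$; it is *surjective* if all three operators are. A *pseudoinverse* of $A$ is a morphism $B\colon E_2\to E_1$ with $ABA=A$ and $BAB=B$ for which $H_{A}H_{B}$ and $H_{B}H_{A}$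 are self-adjoint. A *para-Hilbert bundle* of class $C^{l,\alpha}_{\rm loc}$ over a Banach manifold consists of Banach bundles $X_E,H_E,Y_E$ and bundle morphisms $i_E,j_E,I_E,J_E$, all of class $C^{l,\alpha}_{\rm loc}$, that form a para-Hilbert space in every fibre. Let $k\in\{1,2,\dots\}\cup\{\infty\}$. A *para-Riemannian manifold* $(M,E)$ of class $C^{k,\alpha}_{\rm loc}$ is a Banach manifold $M$ of class $C^{k,\alpha}_{\rm loc}$ with a para-Hilbert bundle $E$ of class $C^{k-1,\alpha}_{\rm loc}$ over $M$ such that $X_E=TM$. A *morphism* $(M_1,E_1)\to(M_2,E_2)$ of class $C^{k,\alpha}_{\rm loc}$ is a $C^{k,\alpha}_{\rm loc}$ map $F\colon M_1\to M_2$ together with a fibrewise morphism $A\colon E_1\to E_2$ over $F$ of class $C^{k-1,\alpha}_{\rm loc}$ with $X_A=TF$. **Theorem.** Let $k\in\{1,2,\dots\}\cup\{\infty\}$ and $\alpha\in[0,1]$. Let $\Phi\colon M_1\to M_2$ be a morphism of class $C^{k,\alpha}_{\rm loc}$ between para-Riemannian manifolds $(M_1,E_1)$ and $(M_2,E_2)$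 of class $C^{k,\alpha}_{\rm loc}$, with induced bundle morphism $A=(T\Phi,H_\Phi,Y_\Phi)\colon E_1\to E_2$. Let $y_0\in M_2$ and $M_0:=\Phi^{-1}(\{y_0\})\subset M_1$, and suppose that for each $x\in M_0$ the morphism $A_x$ is surjective and admits a pseudoinverse. Put $E_0:=\ker(A)|_{M_0}=(\ker X_A,\ker H_A,\ker Y_A)|_{M_0}$ and, for $x\in M_0$, $$\langle I_{E_0}|_x v_1,v_2\rangle:=\langle I_{E_1}|_x v_1,v_2\rangle\quad (v_1,v_2\in H_{E_0}|_x),\qquad \langle J_{E_0}|_x u,w\rangle:=\langle J_{E_1}|_x u,w\rangle\quad (u\in X_{E_0}|_x,\ w\in Y_{E_0}|_x).$$ Then $(M_0,E_0)$ is a para-Riemannian manifold of class $C^{k,\alpha}_{\rm loc}$. More precisely, $M_0$ with the subspace topology carries a structure of Banach manifold of class $C^{k,\alpha}_{\rm loc}$, and $E_0$ with $I_{E_0}$, $J_{E_0}$ a structure of para-Hilbert bundle of class $C^{k-1,\alpha}_{\rm loc}$ with $X_{E_0}=TM_0$, such that the inclusion $M_0\to M_1$, with the fibrewise inclusions $E_0\to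 E_1$, is a morphism of para-Riemannian manifolds of class $C^{k,\alpha}_{\rm loc}$. -/

import Mathlib

open scoped NNReal Topology

universe u v

/-- Near the point `x`, the map `f` is of class `C^{k,α}_loc`: it is `k` times continuously
differentiable and, if `k` is finite, its `k`-th derivative is Hölder continuous with exponent `α`
on a neighbourhood of `x`.  For `α = 0` or `k = ∞` this is the class `C^k`. -/
def CkaAt {V W : Type*} [NormedAddCommGroup V] [NormedSpace ℝ V] [NormedAddCommGroup W]
    [NormedSpace ℝ W] (k : ℕ∞) (α : ℝ≥0) (f : V → W) (x : V) : Prop :=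
  ContDiffAt ℝ k f x ∧
    ∀ n : ℕ, k = n → ∃ U ∈ 𝓝 x, ∃ C : ℝ≥0, HolderOnWith C α (iteratedFDeriv ℝ n f) U

/-- A Banach manifold structure of class `C^{k,α}_loc` on the topological space `M`: an atlas of
charts with values in real Banach spaces.  Different charts may have different model spaces. -/
structure BanachManifold (M : Type u) [TopologicalSpace M] (k : ℕ∞) (α : ℝ≥0) where
  ι : Type u
  V : ι → Type u
  [normed : ∀ c, NormedAddCommGroup (V c)]
  [space : ∀ c, NormedSpace ℝ (V c)]
  [complete : ∀ c, CompleteSpace (V c)]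
  chart : ∀ c, OpenPartialHomeomorph M (V c)
  cover : ∀ x, ∃ c, x ∈ (chart c).source
  compat : ∀ c d x, x ∈ (chart c).source → x ∈ (chart d).source →
    CkaAt k α (chart d ∘ (chart c).symm) (chart c x)

attribute [instance] BanachManifold.normed BanachManifold.space BanachManifold.complete

namespace BanachManifold

variable {M : Type u} [TopologicalSpace M] {N : Type v} [TopologicalSpace N] {k : ℕ∞} {α : ℝ≥0}

/-- Near `x`, the function `f` with values in a normed space is of class `C^{l,α}_loc`. -/
def RegAt (𝔐 : BanachManifold M k α) (l : ℕ∞) {W : Type*} [NormedAddCommGroup W]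
    [NormedSpace ℝ W] (f : M → W) (x : M) : Prop :=
  ∀ c, x ∈ (𝔐.chart c).source → CkaAt l α (f ∘ (𝔐.chart c).symm) (𝔐.chart c x)

/-- The map `f` between Banach manifolds is of class `C^{k,α}_loc`. -/
def IsRegularMap (𝔐 : BanachManifold M k α) (𝔑 : BanachManifold N k α) (f : M → N) : Prop :=
  Continuous f ∧ ∀ c d x, x ∈ (𝔐.chart c).source → f x ∈ (𝔑.chart d).source →
    CkaAt k α (𝔑.chart d ∘ f ∘ (𝔐.chart c).symm) (𝔐.chart c x)

/-- The tangent space at `x`.  A tangent vector is a family of vectors, one in the model space of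
each chart around `x`, that is transformed by the derivatives of the changes of charts
(the entries that belong to the charts not containing `x` are set to zero). -/
def TangentSpace (𝔐 : BanachManifold M k α) (x : M) : Submodule ℝ (∀ c, 𝔐.V c) where
  carrier := {v | (∀ c, x ∉ (𝔐.chart c).source → v c = 0) ∧
    ∀ c d, x ∈ (𝔐.chart c).source → x ∈ (𝔐.chart d).source →
      fderiv ℝ (𝔐.chart d ∘ (𝔐.chart c).symm) (𝔐.chart c x) (v c) = v d}
  add_mem' := fun {a b} ha hb =>
    ⟨fun c hc => by simp [ha.1 c hc, hb.1 c hc],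
      fun c d hc hd => by simp [ha.2 c d hc hd, hb.2 c d hc hd]⟩
  zero_mem' := ⟨fun c _ => rfl, fun c d _ _ => by simp⟩
  smul_mem' := fun r a ha =>
    ⟨fun c hc => by simp [ha.1 c hc], fun c d hc hd => by simp [ha.2 c d hc hd]⟩

/-- The differential of the chart `c` at `x`: the representation of tangent vectors in the chart. -/
def dchart (𝔐 : BanachManifold M k α) (c : 𝔐.ι) (x : M) : 𝔐.TangentSpace x →L[ℝ] 𝔐.V c :=
  (ContinuousLinearMap.proj c).comp (𝔐.TangentSpace x).subtypeL

/-- The vector `w` is the image of the tangent vector `v` under the tangent map of `f` at `x`. -/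
def IsTangentImage (𝔐 : BanachManifold M k α) (𝔑 : BanachManifold N k α) (f : M → N) (x : M)
    (v : 𝔐.TangentSpace x) (w : 𝔑.TangentSpace (f x)) : Prop :=
  ∀ c d, x ∈ (𝔐.chart c).source → f x ∈ (𝔑.chart d).source →
    fderiv ℝ (𝔑.chart d ∘ f ∘ (𝔐.chart c).symm) (𝔐.chart c x) (𝔐.dchart c x v) =
      𝔑.dchart d (f x) w

end BanachManifold

/-- The structure of a Banach bundle of class `C^{l,α}_loc` on the family `F` of topological vector
spaces over the Banach manifold `𝔐`: an atlas of local trivializations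
`triv i x : F x → V i` (`x ∈ baseSet i`) with inverses `trivInv i x`, such that the transition maps,
as maps into the Banach spaces of bounded operators, are of class `C^{l,α}_loc`.
(The values of `triv i` and `trivInv i` outside `baseSet i` are irrelevant.) -/
structure BanachBundle {M : Type u} [TopologicalSpace M] {k : ℕ∞} {α : ℝ≥0}
    (𝔐 : BanachManifold M k α) (l : ℕ∞) (F : M → Type u) [∀ x, AddCommGroup (F x)]
    [∀ x, Module ℝ (F x)] [∀ x, TopologicalSpace (F x)] where
  ι : Type u
  V : ι → Type u
  [normed : ∀ i, NormedAddCommGroup (V i)]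
  [space : ∀ i, NormedSpace ℝ (V i)]
  [complete : ∀ i, CompleteSpace (V i)]
  baseSet : ι → Set M
  isOpen_baseSet : ∀ i, IsOpen (baseSet i)
  cover : ∀ x, ∃ i, x ∈ baseSet i
  triv : ∀ i x, F x →L[ℝ] V i
  trivInv : ∀ i x, V i →L[ℝ] F x
  left_inv : ∀ i x, x ∈ baseSet i → ∀ v, trivInv i x (triv i x v) = v
  right_inv : ∀ i x, x ∈ baseSet i → ∀ w, triv i x (trivInv i x w) = w
  compat : ∀ i j x, x ∈ baseSet i → x ∈ baseSet j →
    𝔐.RegAt l (fun y => (triv j y).comp (trivInv i y)) x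

attribute [instance] BanachBundle.normed BanachBundle.space BanachBundle.complete

namespace BanachBundle

variable {M : Type u} [TopologicalSpace M] {k : ℕ∞} {α : ℝ≥0} {𝔐 : BanachManifold M k α} {l : ℕ∞}
  {F : M → Type u} [∀ x, AddCommGroup (F x)] [∀ x, Module ℝ (F x)] [∀ x, TopologicalSpace (F x)]
  {G : M → Type u} [∀ x, AddCommGroup (G x)] [∀ x, Module ℝ (G x)] [∀ x, TopologicalSpace (G x)]
  {N : Type v} [TopologicalSpace N] {𝔑 : BanachManifold N k α}
  {K : N → Type v} [∀ x, AddCommGroup (K x)] [∀ x, Module ℝ (K x)] [∀ x, TopologicalSpace (K x)]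

/-- The family `A x : F x → K (f x)` is a morphism of Banach bundles of class `C^{l,α}_loc` over the
map `f`: in local trivializations, the operators depend on the point in a `C^{l,α}_loc` manner. -/
def IsMorphismOver (B : BanachBundle 𝔐 l F) (B' : BanachBundle 𝔑 l K) (f : M → N)
    (A : ∀ x, F x →L[ℝ] K (f x)) : Prop :=
  ∀ i j x, x ∈ B.baseSet i → f x ∈ B'.baseSet j →
    𝔐.RegAt l (fun y => ((B'.triv j (f y)).comp (A y)).comp (B.trivInv i y)) x

/-- The family `A x : F x → G x` is a morphism of Banach bundles of class `C^{l,α}_loc` over the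
identity. -/
def IsMorphism (B : BanachBundle 𝔐 l F) (B' : BanachBundle 𝔐 l G)
    (A : ∀ x, F x →L[ℝ] G x) : Prop :=
  B.IsMorphismOver B' id A

/-- The family `A x : F x → (G x)'` is a morphism of class `C^{l,α}_loc` into the dual bundle.
The dual bundle is trivialized by the transposes of the inverse trivializations of `G`. -/
def IsMorphismToDual (B : BanachBundle 𝔐 l F) (B' : BanachBundle 𝔐 l G)
    (A : ∀ x, F x →L[ℝ] G x →L[ℝ] ℝ) : Prop :=
  ∀ i j x, x ∈ B.baseSet i → x ∈ B'.baseSet j →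
    𝔐.RegAt l (fun y => ((ContinuousLinearMap.precomp ℝ (B'.trivInv j y)).comp
      (A y)).comp (B.trivInv i y)) x

/-- The family `τ x : F x → T_x M` is a morphism of class `C^{l,α}_loc` into the tangent bundle,
which is trivialized by the differentials of the charts. -/
def IsMorphismToTangent (B : BanachBundle 𝔐 l F) (τ : ∀ x, F x →L[ℝ] 𝔐.TangentSpace x) : Prop :=
  ∀ i c x, x ∈ B.baseSet i → x ∈ (𝔐.chart c).source →
    𝔐.RegAt l (fun y => ((𝔐.dchart c y).comp (τ y)).comp (B.trivInv i y)) x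

end BanachBundle

/-- A para-Hilbert structure on a triple of (Banachable) spaces `X`, `H`, `Y`: continuous dense
injections `i : X → H` and `j : H → Y`, an inner product on `H` whose Riesz map `I : H → H'` is an
isomorphism (so that the inner product induces the topology of `H`, and `H` is a Hilbert space), and
an isomorphism `J : X → Y'` with `I ∘ i = j' ∘ J`. -/
structure ParaHilbertSpace (X H Y : Type*)
    [AddCommGroup X] [Module ℝ X] [TopologicalSpace X]
    [AddCommGroup H] [Module ℝ H] [TopologicalSpace H]
    [AddCommGroup Y] [Module ℝ Y] [TopologicalSpace Y] where
  i : X →L[ℝ] H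
  j : H →L[ℝ] Y
  I : H →L[ℝ] H →L[ℝ] ℝ
  J : X →L[ℝ] Y →L[ℝ] ℝ
  i_injective : Function.Injective i
  i_dense : DenseRange i
  j_injective : Function.Injective j
  j_dense : DenseRange j
  I_symm : ∀ v w, I v w = I w v
  I_pos : ∀ v, v ≠ 0 → 0 < I v v
  I_iso : I.IsInvertible
  J_iso : J.IsInvertible
  comm : ∀ u v, I (i u) v = J u (j v)

section Linear

variable {X₁ H₁ Y₁ X₂ H₂ Y₂ : Type*}
  [AddCommGroup X₁] [Module ℝ X₁] [TopologicalSpace X₁]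
  [AddCommGroup H₁] [Module ℝ H₁] [TopologicalSpace H₁]
  [AddCommGroup Y₁] [Module ℝ Y₁] [TopologicalSpace Y₁]
  [AddCommGroup X₂] [Module ℝ X₂] [TopologicalSpace X₂]
  [AddCommGroup H₂] [Module ℝ H₂] [TopologicalSpace H₂]
  [AddCommGroup Y₂] [Module ℝ Y₂] [TopologicalSpace Y₂]

/-- A morphism of para-Hilbert spaces: a continuous linear chain map. -/
structure ParaHilbertMor (E₁ : ParaHilbertSpace X₁ H₁ Y₁) (E₂ : ParaHilbertSpace X₂ H₂ Y₂) where
  X : X₁ →L[ℝ] X₂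
  H : H₁ →L[ℝ] H₂
  Y : Y₁ →L[ℝ] Y₂
  comm_i : ∀ u, H (E₁.i u) = E₂.i (X u)
  comm_j : ∀ v, Y (E₁.j v) = E₂.j (H v)

namespace ParaHilbertMor

variable {E₁ : ParaHilbertSpace X₁ H₁ Y₁} {E₂ : ParaHilbertSpace X₂ H₂ Y₂}

/-- A morphism is surjective if it is so on each of the three scales. -/
def IsSurjective (A : ParaHilbertMor E₁ E₂) : Prop :=
  Function.Surjective A.X ∧ Function.Surjective A.H ∧ Function.Surjective A.Y

/-- `B` is a generalized inverse of `A`: `A B A = A` and `B A B = B`. -/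
def IsGeneralizedInverse (A : ParaHilbertMor E₁ E₂) (B : ParaHilbertMor E₂ E₁) : Prop :=
  (∀ u, A.X (B.X (A.X u)) = A.X u) ∧ (∀ u, B.X (A.X (B.X u)) = B.X u) ∧
  (∀ v, A.H (B.H (A.H v)) = A.H v) ∧ (∀ v, B.H (A.H (B.H v)) = B.H v) ∧
  (∀ w, A.Y (B.Y (A.Y w)) = A.Y w) ∧ (∀ w, B.Y (A.Y (B.Y w)) = B.Y w)

/-- `B` is a pseudoinverse of `A`: a generalized inverse for which `A B` and `B A` are orthogonal
projectors on the Hilbert scale. -/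
def IsPseudoinverse (A : ParaHilbertMor E₁ E₂) (B : ParaHilbertMor E₂ E₁) : Prop :=
  A.IsGeneralizedInverse B ∧
  (∀ v w, E₂.I (A.H (B.H v)) w = E₂.I v (A.H (B.H w))) ∧
  (∀ v w, E₁.I (B.H (A.H v)) w = E₁.I v (B.H (A.H w)))

end ParaHilbertMor

end Linear

/-- A para-Hilbert bundle of class `C^{l,α}_loc` with fibres `X x`, `H x`, `Y x`. -/
structure ParaHilbertBundle {M : Type u} [TopologicalSpace M] {k : ℕ∞} {α : ℝ≥0}
    (𝔐 : BanachManifold M k α) (l : ℕ∞) (X H Y : M → Type u)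
    [∀ x, AddCommGroup (X x)] [∀ x, Module ℝ (X x)] [∀ x, TopologicalSpace (X x)]
    [∀ x, AddCommGroup (H x)] [∀ x, Module ℝ (H x)] [∀ x, TopologicalSpace (H x)]
    [∀ x, AddCommGroup (Y x)] [∀ x, Module ℝ (Y x)] [∀ x, TopologicalSpace (Y x)] where
  bX : BanachBundle 𝔐 l X
  bH : BanachBundle 𝔐 l H
  bY : BanachBundle 𝔐 l Y
  fib : ∀ x, ParaHilbertSpace (X x) (H x) (Y x)
  regular_i : bX.IsMorphism bH fun x => (fib x).i
  regular_j : bH.IsMorphism bY fun x => (fib x).j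
  regular_I : bH.IsMorphismToDual bH fun x => (fib x).I
  regular_J : bX.IsMorphismToDual bY fun x => (fib x).J

/-- A para-Riemannian manifold of class `C^{k,α}_loc`: a Banach manifold of class `C^{k,α}_loc` with
a para-Hilbert bundle of class `C^{k-1,α}_loc` whose bundle `X` is identified with the tangent bundle
by the bundle isomorphism `τ`. -/
structure ParaRiemannianManifold (M : Type u) [TopologicalSpace M] (k : ℕ∞) (α : ℝ≥0)
    (X H Y : M → Type u)
    [∀ x, AddCommGroup (X x)] [∀ x, Module ℝ (X x)] [∀ x, TopologicalSpace (X x)]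
    [∀ x, AddCommGroup (H x)] [∀ x, Module ℝ (H x)] [∀ x, TopologicalSpace (H x)]
    [∀ x, AddCommGroup (Y x)] [∀ x, Module ℝ (Y x)] [∀ x, TopologicalSpace (Y x)] where
  mfd : BanachManifold M k α
  E : ParaHilbertBundle mfd (k - 1) X H Y
  τ : ∀ x, X x ≃L[ℝ] mfd.TangentSpace x
  regular_τ : E.bX.IsMorphismToTangent fun x => (τ x : X x →L[ℝ] mfd.TangentSpace x)

section Morphism

variable {M₁ : Type u} [TopologicalSpace M₁] {M₂ : Type v} [TopologicalSpace M₂]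
  {k : ℕ∞} {α : ℝ≥0} {X₁ H₁ Y₁ : M₁ → Type u} {X₂ H₂ Y₂ : M₂ → Type v}
  [∀ x, AddCommGroup (X₁ x)] [∀ x, Module ℝ (X₁ x)] [∀ x, TopologicalSpace (X₁ x)]
  [∀ x, AddCommGroup (H₁ x)] [∀ x, Module ℝ (H₁ x)] [∀ x, TopologicalSpace (H₁ x)]
  [∀ x, AddCommGroup (Y₁ x)] [∀ x, Module ℝ (Y₁ x)] [∀ x, TopologicalSpace (Y₁ x)]
  [∀ x, AddCommGroup (X₂ x)] [∀ x, Module ℝ (X₂ x)] [∀ x, TopologicalSpace (X₂ x)]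
  [∀ x, AddCommGroup (H₂ x)] [∀ x, Module ℝ (H₂ x)] [∀ x, TopologicalSpace (H₂ x)]
  [∀ x, AddCommGroup (Y₂ x)] [∀ x, Module ℝ (Y₂ x)] [∀ x, TopologicalSpace (Y₂ x)]

/-- The map `f` is a morphism of para-Riemannian manifolds of class `C^{k,α}_loc` with the induced
morphism `mor` of para-Hilbert bundles, which is of class `C^{k-1,α}_loc` and extends the tangent map
of `f`. -/
structure ParaRiemannianMor (P₁ : ParaRiemannianManifold M₁ k α X₁ H₁ Y₁)
    (P₂ : ParaRiemannianManifold M₂ k α X₂ H₂ Y₂) (f : M₁ → M₂) where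
  regular : P₁.mfd.IsRegularMap P₂.mfd f
  mor : ∀ x, ParaHilbertMor (P₁.E.fib x) (P₂.E.fib (f x))
  regular_X : P₁.E.bX.IsMorphismOver P₂.E.bX f fun x => (mor x).X
  regular_H : P₁.E.bH.IsMorphismOver P₂.E.bH f fun x => (mor x).H
  regular_Y : P₁.E.bY.IsMorphismOver P₂.E.bY f fun x => (mor x).Y
  tangent : ∀ x u, P₁.mfd.IsTangentImage P₂.mfd f x (P₁.τ x u) (P₂.τ (f x) ((mor x).X u))

end Morphism

/-!
If `B` is a pseudoinverse of a surjective morphism `A`, then `A B = 1`, so that `1 - B A` projects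
onto `ker A` on each of the three scales. Hence `Φ` is a submersion along the level set, and the
inverse function theorem, which preserves the class `C^{k,α}`, yields charts of `M₁` in which `Φ`
is the first projection of a product. The level set is a slice of these charts, and the kernels of
`A` are trivialized near a point `x` by inverting the family `y ↦ (A y, P)`, where `P` projects onto
the kernel of `A x`.

The maps `i` and `j` intertwine the projections `1 - B A`, so they keep dense image on the kernels.
The forms `I` and `J` restrict to isomorphisms because `1 - B A` is symmetric for them: for `I` this
is part of the definition of a pseudoinverse, and it carries over to `J` by the density of `j`.
-/

open Set Filter

/-- The map `f` is Hölder continuous with exponent `α` on a neighbourhood of `x`: the condition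
that `CkaAt` imposes on the highest derivative. -/
def HolderNear {X Y : Type*} [PseudoEMetricSpace X] [PseudoEMetricSpace Y] (α : ℝ≥0) (f : X → Y)
    (x : X) : Prop :=
  ∃ U ∈ 𝓝 x, ∃ C : ℝ≥0, HolderOnWith C α f U

namespace HolderNear

variable {X Y Z : Type*} [PseudoEMetricSpace X] [PseudoEMetricSpace Y] [PseudoEMetricSpace Z]
  {α : ℝ≥0} {f g : X → Y} {x : X}

theorem congr (hf : HolderNear α f x) (h : f =ᶠ[𝓝 x] g) : HolderNear α g x := by
  obtain ⟨U, hU, C, hC⟩ := hf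
  refine ⟨U ∩ {y | f y = g y}, inter_mem hU h, C, fun y hy z hz => ?_⟩
  rw [← hy.2, ← hz.2]
  exact hC y hy.1 z hz.1

theorem comp_lipschitz {g : Y → Z} (hg : HolderNear α g (f x)) (hf : HolderNear 1 f x)
    (hc : ContinuousAt f x) : HolderNear α (g ∘ f) x := by
  obtain ⟨U, hU, C, hC⟩ := hf
  obtain ⟨W, hW, D, hD⟩ := hg
  refine ⟨U ∩ f ⁻¹' W, inter_mem hU (hc hW), D * C ^ (α : ℝ), ?_⟩
  simpa using hD.comp (hC.mono (inter_subset_left (t := f ⁻¹' W))) fun y hy => hy.2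

theorem lipschitz_comp {g : Y → Z} (hg : HolderNear 1 g (f x)) (hf : HolderNear α f x)
    (hc : ContinuousAt f x) : HolderNear α (g ∘ f) x := by
  obtain ⟨U, hU, C, hC⟩ := hf
  obtain ⟨W, hW, D, hD⟩ := hg
  refine ⟨U ∩ f ⁻¹' W, inter_mem hU (hc hW), D * C ^ ((1 : ℝ≥0) : ℝ), ?_⟩
  simpa only [one_mul] using
    hD.comp (hC.mono (inter_subset_left (t := f ⁻¹' W))) fun y hy => hy.2

theorem prodMk {g : X → Z} (hf : HolderNear α f x) (hg : HolderNear α g x) :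
    HolderNear α (fun y => (f y, g y)) x := by
  obtain ⟨U, hU, C, hC⟩ := hf
  obtain ⟨W, hW, D, hD⟩ := hg
  refine ⟨U ∩ W, inter_mem hU hW, max C D, fun y hy z hz => ?_⟩
  rw [Prod.edist_eq]
  exact max_le (hC.mono_const (le_max_left C D) y hy.1 z hz.1)
    (hD.mono_const (le_max_right C D) y hy.2 z hz.2)

theorem pi {ι : Type*} [Fintype ι] {Y : ι → Type*} [∀ i, PseudoEMetricSpace (Y i)]
    {f : X → ∀ i, Y i} (hf : ∀ i, HolderNear α (fun y => f y i) x) : HolderNear α f x := by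
  choose U hU C hC using hf
  refine ⟨⋂ i, U i, iInter_mem.2 hU, ∑ i, C i, fun y hy z hz => edist_pi_le_iff.2 fun i => ?_⟩
  have hi : C i ≤ ∑ i, C i := Finset.single_le_sum (fun _ _ => zero_le) (Finset.mem_univ i)
  exact (hC i).mono_const hi y (mem_iInter.1 hy i) z (mem_iInter.1 hz i)

theorem isometry_comp_iff {g : Y → Z} (hg : Isometry g) :
    HolderNear α (g ∘ f) x ↔ HolderNear α f x := by
  simp only [HolderNear, HolderOnWith, Function.comp_apply, hg.edist_eq]

end HolderNear

section Calculus

variable {V W Z : Type*} [NormedAddCommGroup V] [NormedSpace ℝ V] [NormedAddCommGroup W]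
  [NormedSpace ℝ W] [NormedAddCommGroup Z] [NormedSpace ℝ Z]

theorem HolderNear.of_hasStrictFDerivAt {α : ℝ≥0} (hα : α ≤ 1) {f : V → W} {f' : V →L[ℝ] W}
    {x : V} (hf : HasStrictFDerivAt f f' x) : HolderNear α f x := by
  obtain ⟨K, t, ht, hK⟩ := hf.exists_lipschitzOnWith
  -- Lowering the exponent of a Lipschitz map requires a bounded domain.
  refine ⟨t ∩ Metric.closedEBall x 1, inter_mem ht (Metric.closedEBall_mem_nhds x one_pos), _,
    ((holderOnWith_one.2 hK).mono inter_subset_left).of_le (D := 2) (fun y hy z hz => ?_) hα⟩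
  calc edist y z ≤ edist y x + edist z x := edist_triangle_right _ _ _
    _ ≤ 1 + 1 := add_le_add hy.2 hz.2
    _ = _ := by norm_num

theorem HolderNear.of_contDiffAt {α : ℝ≥0} (hα : α ≤ 1) {f : V → W} {x : V}
    (hf : ContDiffAt ℝ 1 f x) : HolderNear α f x :=
  .of_hasStrictFDerivAt hα (hf.hasStrictFDerivAt one_ne_zero)

theorem HolderNear.sum {α : ℝ≥0} (hα : α ≤ 1) {ι : Type*} (s : Finset ι) {f : ι → V → W} {x : V}
    (hf : ∀ i ∈ s, HolderNear α (f i) x) (hc : ∀ i ∈ s, ContinuousAt (f i) x) :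
    HolderNear α (fun y => ∑ i ∈ s, f i y) x := by
  classical
  induction s using Finset.induction_on with
  | empty =>
    simp only [Finset.sum_empty]
    exact .of_contDiffAt hα contDiffAt_const
  | insert i s hi ih =>
    simp only [Finset.sum_insert hi]
    rw [Finset.forall_mem_insert] at hf hc
    have hadd : ContDiff ℝ 1 (fun p : W × W => p.1 + p.2) := by fun_prop
    exact (HolderNear.of_contDiffAt le_rfl hadd.contDiffAt).lipschitz_comp
      (hf.1.prodMk (ih hf.2 hc.2)) (hc.1.prodMk (tendsto_finsetSum s hc.2))

theorem HolderNear.clm_apply_multilinear {X ι : Type*} [PseudoEMetricSpace X] [Finite ι]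
    {G : ι → Type*} [∀ i, NormedAddCommGroup (G i)] [∀ i, NormedSpace ℝ (G i)]
    (B : W →L[ℝ] ContinuousMultilinearMap ℝ G Z) {α : ℝ≥0} {x : X} {q : X → W}
    {p : ∀ i, X → G i} (hq : HolderNear α q x) (hqc : ContinuousAt q x)
    (hp : ∀ i, HolderNear α (p i) x) (hpc : ∀ i, ContinuousAt (p i) x) :
    HolderNear α (fun y => B (q y) fun i => p i y) x ∧
      ContinuousAt (fun y => B (q y) fun i => p i y) x := by
  have := Fintype.ofFinite ι
  let r : X → W × ∀ i, G i := fun y => (q y, fun i => p i y)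
  have hB := (B.analyticOnNhd_uncurry_of_multilinear (r x) (mem_univ _)).hasStrictFDerivAt
  have hr : ContinuousAt r x := hqc.prodMk (continuousAt_pi.2 hpc)
  exact ⟨(HolderNear.of_hasStrictFDerivAt le_rfl hB).lipschitz_comp (f := r)
    (hq.prodMk (.pi hp)) hr, ContinuousAt.comp (f := r) hB.continuousAt hr⟩

namespace CkaAt

variable {k l : ℕ∞} {α : ℝ≥0} {f g : V → W} {x : V}

theorem holderNear {n : ℕ} (hf : CkaAt n α f x) : HolderNear α (iteratedFDeriv ℝ n f) x :=
  hf.2 n rfl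

theorem congr (hf : CkaAt k α f x) (h : f =ᶠ[𝓝 x] g) : CkaAt k α g x := by
  refine ⟨hf.1.congr_of_eventuallyEq h.symm, fun n hn => ?_⟩
  subst hn
  exact hf.holderNear.congr (h.iteratedFDeriv ℝ n)

theorem of_contDiffAt (hα : α ≤ 1) (h : ContDiffAt ℝ (k + 1 : ℕ∞) f x) : CkaAt k α f x := by
  refine ⟨h.of_le (by exact_mod_cast le_self_add), fun n hn => ?_⟩
  subst hn
  exact HolderNear.of_contDiffAt hα
    (h.iteratedFDeriv_right (m := 1) (i := n) (by push_cast; rw [add_comm]))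

theorem mono (hα : α ≤ 1) (hf : CkaAt k α f x) (h : l ≤ k) : CkaAt l α f x := by
  rcases h.eq_or_lt with rfl | h
  · exact hf
  · exact of_contDiffAt hα (hf.1.of_le (by exact_mod_cast Order.add_one_le_of_lt h))

theorem contDiffAt_one (hf : CkaAt k α f x) (hk : 1 ≤ k) : ContDiffAt ℝ 1 f x :=
  hf.1.of_le (by exact_mod_cast hk)

theorem differentiableAt (hf : CkaAt k α f x) (hk : 1 ≤ k) : DifferentiableAt ℝ f x :=
  (hf.contDiffAt_one hk).differentiableAt one_ne_zero

theorem continuousAt (hf : CkaAt k α f x) : ContinuousAt f x := hf.1.continuousAt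

theorem holderNear_iteratedFDeriv (hα : α ≤ 1) {n m : ℕ} (hf : CkaAt n α f x) (hm : m ≤ n) :
    HolderNear α (iteratedFDeriv ℝ m f) x :=
  (hf.mono hα (by exact_mod_cast hm)).holderNear

theorem continuousAt_iteratedFDeriv {n m : ℕ} (hf : CkaAt n α f x) (hm : m ≤ n) :
    ContinuousAt (iteratedFDeriv ℝ m f) x :=
  hf.1.continuousAt_iteratedFDeriv (by exact_mod_cast hm)

theorem holderNear_iteratedFDeriv_zero_iff :
    HolderNear α (iteratedFDeriv ℝ 0 f) x ↔ HolderNear α f x := by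
  rw [iteratedFDeriv_zero_eq_comp, HolderNear.isometry_comp_iff (LinearIsometryEquiv.isometry _)]

theorem eventually_iteratedFDeriv_comp {n : ℕ} {g : W → Z} (hg : CkaAt n α g (f x))
    (hf : CkaAt n α f x) : (fun y => (ftaylorSeries ℝ g (f y)).taylorComp (ftaylorSeries ℝ f y) n)
      =ᶠ[𝓝 x] iteratedFDeriv ℝ n (g ∘ f) := by
  filter_upwards [hf.1.eventually (by simp), hf.continuousAt.eventually (hg.1.eventually (by simp))]
    with y hfy hgy
  exact (iteratedFDeriv_comp hgy hfy (by simp)).symm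

theorem holderNear_taylorComp (hα : α ≤ 1) {n : ℕ} {g : W → Z} (hg : CkaAt n α g (f x))
    (hf : CkaAt n α f x) (hf₁ : ContDiffAt ℝ 1 f x) :
    HolderNear α (fun y => (ftaylorSeries ℝ g (f y)).taylorComp (ftaylorSeries ℝ f y) n) x := by
  have hterm (c : OrderedFinpartition n) :=
    HolderNear.clm_apply_multilinear (c.compAlongOrderedFinpartitionL ℝ V W Z)
      ((hg.holderNear_iteratedFDeriv hα c.length_le).comp_lipschitz (.of_contDiffAt le_rfl hf₁)
        hf.continuousAt)
      (ContinuousAt.comp (g := iteratedFDeriv ℝ c.length g)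
        (hg.continuousAt_iteratedFDeriv c.length_le) hf.continuousAt)
      (fun m => hf.holderNear_iteratedFDeriv hα (c.partSize_le m))
      fun m => hf.continuousAt_iteratedFDeriv (c.partSize_le m)
  exact .sum hα _ (fun c _ => (hterm c).1) fun c _ => (hterm c).2

-- For `k = 0` the composition of two `α`-Hölder maps is only `α ^ 2`-Hölder.
theorem comp (hα : α ≤ 1) {g : W → Z} (hg : CkaAt k α g (f x)) (hf : CkaAt k α f x)
    (h : ContDiffAt ℝ 1 g (f x) ∨ ContDiffAt ℝ 1 f x) : CkaAt k α (g ∘ f) x := by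
  refine ⟨hg.1.comp x hf.1, fun n hn => ?_⟩
  subst hn
  change HolderNear α (iteratedFDeriv ℝ n (g ∘ f)) x
  rcases Nat.eq_zero_or_pos n with rfl | hn
  · have hf₀ := holderNear_iteratedFDeriv_zero_iff.1 hf.holderNear
    have hg₀ := holderNear_iteratedFDeriv_zero_iff.1 hg.holderNear
    refine holderNear_iteratedFDeriv_zero_iff.2 (h.elim (fun h => ?_) fun h => ?_)
    · exact (HolderNear.of_contDiffAt le_rfl h).lipschitz_comp hf₀ hf.continuousAt
    · exact hg₀.comp_lipschitz (.of_contDiffAt le_rfl h) hf.continuousAt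
  · exact (hg.holderNear_taylorComp hα hf (hf.contDiffAt_one (by exact_mod_cast hn))).congr
      (hg.eventually_iteratedFDeriv_comp hf)

theorem contDiffAt_comp (hα : α ≤ 1) {g : W → Z} (hg : ∀ n : ℕ∞, ContDiffAt ℝ n g (f x))
    (hf : CkaAt k α f x) : CkaAt k α (g ∘ f) x :=
  comp hα (of_contDiffAt hα (hg _)) hf (Or.inl (hg 1))

theorem contDiff_comp (hα : α ≤ 1) {g : W → Z} (hg : ∀ n : ℕ∞, ContDiff ℝ n g)
    (hf : CkaAt k α f x) : CkaAt k α (g ∘ f) x :=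
  hf.contDiffAt_comp hα fun n => (hg n).contDiffAt

theorem of_contDiff (hα : α ≤ 1) (hf : ∀ n : ℕ∞, ContDiff ℝ n f) : CkaAt k α f x :=
  of_contDiffAt hα (hf _).contDiffAt

theorem const (hα : α ≤ 1) (w : W) : CkaAt k α (fun _ : V => w) x :=
  of_contDiff hα fun _ => contDiff_const

theorem continuousLinearMap_comp (hα : α ≤ 1) (L : W →L[ℝ] Z) (hf : CkaAt k α f x) :
    CkaAt k α (fun y => L (f y)) x :=
  contDiff_comp hα (fun _ => L.contDiff) hf

theorem prodMk (hf : CkaAt k α f x) {g : V → Z} (hg : CkaAt k α g x) :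
    CkaAt k α (fun y => (f y, g y)) x := by
  refine ⟨hf.1.prodMk hg.1, fun n hn => ?_⟩
  subst hn
  have hev : ∀ᶠ y in 𝓝 x, iteratedFDeriv ℝ n (fun y => (f y, g y)) y =
      (iteratedFDeriv ℝ n f y).prod (iteratedFDeriv ℝ n g y) := by
    filter_upwards [hf.1.eventually (by simp), hg.1.eventually (by simp)] with y hy hy'
    exact iteratedFDeriv_prodMk hy hy' (by simp)
  have h := hf.holderNear.prodMk hg.holderNear
  rw [← HolderNear.isometry_comp_iff
    (ContinuousMultilinearMap.prodL ℝ (fun _ : Fin n => V) W Z).isometry] at h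
  exact h.congr (EventuallyEq.symm hev)

section Operators

variable {V' W' Z' : Type*} [NormedAddCommGroup V'] [NormedSpace ℝ V'] [NormedAddCommGroup W']
  [NormedSpace ℝ W'] [NormedAddCommGroup Z'] [NormedSpace ℝ Z']

theorem clm_comp (hα : α ≤ 1) {S : V → W' →L[ℝ] Z'} {T : V → V' →L[ℝ] W'}
    (hS : CkaAt k α S x) (hT : CkaAt k α T x) : CkaAt k α (fun y => (S y).comp (T y)) x :=
  contDiff_comp hα (g := fun p : (W' →L[ℝ] Z') × (V' →L[ℝ] W') => p.1.comp p.2)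
    (fun _ => contDiff_fst.clm_comp contDiff_snd) (hS.prodMk hT)

theorem clm_prod (hα : α ≤ 1) {S : V → V' →L[ℝ] W'} {T : V → V' →L[ℝ] Z'}
    (hS : CkaAt k α S x) (hT : CkaAt k α T x) : CkaAt k α (fun y => (S y).prod (T y)) x :=
  contDiff_comp hα (g := fun p : (V' →L[ℝ] W') × (V' →L[ℝ] Z') => p.1.prod p.2)
    (fun _ => (ContinuousLinearMap.prodₗᵢ (𝕜 := ℝ) (E := V') (F := W') (G := Z') ℝ).contDiff)
    (hS.prodMk hT)

theorem inverse [CompleteSpace V'] (hα : α ≤ 1) {T : V → V' →L[ℝ] W'} (hT : CkaAt k α T x)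
    (h : (T x).IsInvertible) : CkaAt k α (fun y => (T y).inverse) x :=
  contDiffAt_comp hα (fun _ => h.contDiffAt_map_inverse) hT

end Operators

theorem holderNear_iteratedFDeriv_fderiv_iff {n : ℕ} :
    HolderNear α (iteratedFDeriv ℝ n (fderiv ℝ f)) x ↔
      HolderNear α (iteratedFDeriv ℝ (n + 1) f) x := by
  have : iteratedFDeriv ℝ (n + 1) f = (continuousMultilinearCurryRightEquiv' ℝ n V W).symm ∘
      iteratedFDeriv ℝ n (fderiv ℝ f) := funext fun y => iteratedFDeriv_succ_eq_comp_right
  rw [this, HolderNear.isometry_comp_iff (LinearIsometryEquiv.isometry _)]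

theorem fderiv (hf : CkaAt k α f x) (hk : 1 ≤ k) : CkaAt (k - 1) α (fderiv ℝ f) x := by
  refine ⟨hf.1.fderiv_right (by exact_mod_cast (tsub_add_cancel_of_le hk).le), fun n hn => ?_⟩
  have hk' : k = (n + 1 : ℕ) := by
    rw [← tsub_add_cancel_of_le hk, hn]; push_cast; rfl
  subst hk'
  exact holderNear_iteratedFDeriv_fderiv_iff.2 hf.holderNear

theorem of_fderiv (hf : ContDiffAt ℝ k f x) (hk : 1 ≤ k)
    (h : CkaAt (k - 1) α (_root_.fderiv ℝ f) x) : CkaAt k α f x := by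
  refine ⟨hf, fun n hn => ?_⟩
  subst hn
  obtain ⟨m, rfl⟩ : ∃ m, n = m + 1 := Nat.exists_eq_succ_of_ne_zero fun h0 => by simp [h0] at hk
  have hm : ((m + 1 : ℕ) : ℕ∞) - 1 = m := by simpa using (ENat.natCast_sub (m + 1) 1).symm
  rw [hm] at h
  exact holderNear_iteratedFDeriv_fderiv_iff.1 h.holderNear

end CkaAt

theorem eventually_isInvertible [CompleteSpace V] {X : Type*} [TopologicalSpace X]
    {T : X → V →L[ℝ] W} {x : X} (hT : ContinuousAt T x) (h : (T x).IsInvertible) :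
    ∀ᶠ y in 𝓝 x, (T y).IsInvertible := by
  obtain ⟨e, he⟩ := h
  exact hT (he ▸ e.nhds)

/-! ### Inverse and implicit functions of class `C^{k,α}_loc` -/

theorem fderiv_symm_eq_inverse (g : OpenPartialHomeomorph V W) {x : V} (hx : x ∈ g.source)
    (hg : DifferentiableAt ℝ g x) (h : (fderiv ℝ g x).IsInvertible) :
    fderiv ℝ g.symm (g x) = (fderiv ℝ g x).inverse := by
  obtain ⟨L, hL⟩ := h
  have hd : HasFDerivAt g (L : V →L[ℝ] W) (g.symm (g x)) := by
    rw [hL, g.left_inv hx]; exact hg.hasFDerivAt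
  rw [(g.hasFDerivAt_symm (g.map_source hx) hd).fderiv, ← hL, ContinuousLinearMap.inverse_equiv]

theorem CkaAt.openPartialHomeomorph_symm [CompleteSpace V] {k : ℕ∞} (hk : 1 ≤ k) {α : ℝ≥0}
    (hα : α ≤ 1) (g : OpenPartialHomeomorph V W) {x : V} (hx : x ∈ g.source)
    (hg : CkaAt k α g x) (h : (_root_.fderiv ℝ g x).IsInvertible) : CkaAt k α g.symm (g x) := by
  have hsymm : ContDiffAt ℝ k g.symm (g x) := by
    obtain ⟨L, hL⟩ := h
    have hd : HasFDerivAt g (L : V →L[ℝ] W) x := hL ▸ (hg.differentiableAt hk).hasFDerivAt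
    rw [← g.left_inv hx] at hg hd
    exact g.contDiffAt_symm (g.map_source hx) hd hg.1
  have hcont : Tendsto g.symm (𝓝 (g x)) (𝓝 x) := by
    simpa only [g.left_inv hx] using hsymm.continuousAt.tendsto
  have hsymm' : CkaAt (k - 1) α g.symm (g x) :=
    .of_contDiffAt hα (by rwa [tsub_add_cancel_of_le hk])
  have hcomp : CkaAt (k - 1) α (_root_.fderiv ℝ g ∘ g.symm) (g x) :=
    .comp hα (by rw [g.left_inv hx]; exact hg.fderiv hk) hsymm'
      (Or.inr (hsymm.of_le (by exact_mod_cast hk)))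
  refine .of_fderiv hsymm hk ((hcomp.inverse hα ?_).congr ?_)
  · rwa [Function.comp_apply, g.left_inv hx]
  · have hinv := eventually_isInvertible (hg.fderiv hk).continuousAt h
    have hdiff := (hg.contDiffAt_one hk).eventually (by simp)
    filter_upwards [hcont.eventually hinv, hcont.eventually hdiff,
      g.open_target.mem_nhds (g.map_source hx)] with z hz hz' hzt
    have := fderiv_symm_eq_inverse g (g.map_target hzt) (hz'.differentiableAt one_ne_zero) hz
    rwa [g.right_inv hzt, eq_comm] at this

/-- The open partial homeomorphism `g` is a diffeomorphism of class `C^{k,α}_loc` from its source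
onto its target. -/
structure IsCkaDiffeo (k : ℕ∞) (α : ℝ≥0) (g : OpenPartialHomeomorph V W) : Prop where
  ckaAt : ∀ x ∈ g.source, CkaAt k α g x
  ckaAt_symm : ∀ x ∈ g.source, CkaAt k α g.symm (g x)

-- The regularity is required near `p` because for `k = ∞` it is not an open condition.
theorem exists_isCkaDiffeo_of_isInvertible [CompleteSpace V] {k : ℕ∞} (hk : 1 ≤ k) {α : ℝ≥0}
    (hα : α ≤ 1) {f : V → W} {p : V} (hf : ∀ᶠ x in 𝓝 p, CkaAt k α f x)
    (h : (fderiv ℝ f p).IsInvertible) :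
    ∃ g : OpenPartialHomeomorph V W, p ∈ g.source ∧ ⇑g = f ∧ IsCkaDiffeo k α g := by
  have hp := hf.self_of_nhds
  have hinv : ∀ᶠ x in 𝓝 p, (fderiv ℝ f x).IsInvertible :=
    eventually_isInvertible (hp.fderiv hk).continuousAt h
  obtain ⟨s, hs, hso, hps⟩ := eventually_nhds_iff.1 (hf.and hinv)
  obtain ⟨L, hL⟩ := h
  let g := hp.1.toOpenPartialHomeomorph f (hL ▸ (hp.differentiableAt hk).hasFDerivAt)
    (by exact_mod_cast (zero_lt_one.trans_le hk).ne')
  refine ⟨g.restrOpen s hso, ⟨hp.1.mem_toOpenPartialHomeomorph_source _ _, hps⟩, rfl,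
    ⟨fun x hx => (hs x hx.2).1, fun x hx => ?_⟩⟩
  exact .openPartialHomeomorph_symm hk hα g hx.1 (hs x hx.2).1 (hs x hx.2).2

theorem exists_isCkaDiffeo_fst_eq [CompleteSpace V] {k : ℕ∞} (hk : 1 ≤ k) {α : ℝ≥0}
    (hα : α ≤ 1) {f : V → W} {p : V} (hf : ∀ᶠ x in 𝓝 p, CkaAt k α f x) (R : W →L[ℝ] V)
    (hR : Function.RightInverse R (fderiv ℝ f p)) :
    ∃ g : OpenPartialHomeomorph V (W × (fderiv ℝ f p).ker),
      p ∈ g.source ∧ (∀ x, (g x).1 = f x) ∧ IsCkaDiffeo k α g := by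
  let P := (fderiv ℝ f p).projKerOfRightInverse R hR
  have hG : HasFDerivAt (fun x => (f x, P x)) ((fderiv ℝ f p).prod P) p :=
    (hf.self_of_nhds.differentiableAt hk).hasFDerivAt.prodMk P.hasFDerivAt
  have hinv : (fderiv ℝ (fun x => (f x, P x)) p).IsInvertible :=
    ⟨.equivOfRightInverse (fderiv ℝ f p) R hR, hG.fderiv.symm⟩
  obtain ⟨g, hp, hgG, hg⟩ := exists_isCkaDiffeo_of_isInvertible hk hα
    (hf.mono fun x hx => hx.prodMk (.of_contDiff hα fun _ => P.contDiff)) hinv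
  exact ⟨g, hp, fun x => by rw [hgG], hg⟩

end Calculus

/-! ### Kernels of split operators and of pseudoinvertible morphisms -/

section Kernel

variable {F G F' G' : Type*} [AddCommGroup F] [Module ℝ F] [TopologicalSpace F]
  [AddCommGroup G] [Module ℝ G] [TopologicalSpace G]
  [AddCommGroup F'] [Module ℝ F'] [TopologicalSpace F']
  [AddCommGroup G'] [Module ℝ G'] [TopologicalSpace G']

/-- The restriction of the bilinear form `I` to subspaces of its two arguments. -/
noncomputable def restrictForm (I : F →L[ℝ] G →L[ℝ] ℝ) (p : Submodule ℝ F) (q : Submodule ℝ G) :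
    p →L[ℝ] q →L[ℝ] ℝ :=
  (ContinuousLinearMap.precomp ℝ q.subtypeL).comp (I.comp p.subtypeL)

/-- The projection `1 - b a` onto the kernel of `a`, for an operator `b` with `a b a = a`. -/
def kerProj [IsTopologicalAddGroup F] (a : F →L[ℝ] G) (b : G →L[ℝ] F)
    (h : ∀ v, a (b (a v)) = a v) : F →L[ℝ] LinearMap.ker a.toLinearMap :=
  (ContinuousLinearMap.id ℝ F - b.comp a).codRestrict _ fun v => by simp [h]

theorem coe_kerProj [IsTopologicalAddGroup F] (a : F →L[ℝ] G) (b : G →L[ℝ] F)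
    (h : ∀ v, a (b (a v)) = a v) (v : F) : (kerProj a b h v : F) = v - b (a v) := rfl

theorem kerProj_coe [IsTopologicalAddGroup F] {a : F →L[ℝ] G} {b : G →L[ℝ] F}
    (h : ∀ v, a (b (a v)) = a v) (v : LinearMap.ker a.toLinearMap) : kerProj a b h v = v := by
  have hv : a v = 0 := v.2
  exact Subtype.ext (by rw [coe_kerProj, hv, map_zero, sub_zero])

theorem surjective_kerProj [IsTopologicalAddGroup F] {a : F →L[ℝ] G} {b : G →L[ℝ] F}
    (h : ∀ v, a (b (a v)) = a v) : Function.Surjective (kerProj a b h) :=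
  fun v => ⟨v, kerProj_coe h v⟩

theorem isInvertible_restrictForm_ker [IsTopologicalAddGroup F] [IsTopologicalAddGroup G]
    {I : F →L[ℝ] G →L[ℝ] ℝ} (hI : I.IsInvertible) {a : F →L[ℝ] F'} {b : F' →L[ℝ] F}
    {c : G →L[ℝ] G'} {d : G' →L[ℝ] G} (hab : ∀ v, a (b (a v)) = a v)
    (hcd : ∀ w, c (d (c w)) = c w) (h : ∀ v w, I (b (a v)) w = I v (d (c w))) :
    (restrictForm I (LinearMap.ker a.toLinearMap) (LinearMap.ker c.toLinearMap)).IsInvertible := by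
  obtain ⟨e, rfl⟩ := hI
  let p := kerProj a b hab
  let q := kerProj c d hcd
  have hadj (v : F) (w : G) : e (p v) w = e v (q w) := by
    have : e (b (a v)) w = e v (d (c w)) := h v w
    change e (v - b (a v)) w = e v (w - d (c w))
    rw [map_sub, map_sub, sub_apply, this]
  have hp (v : LinearMap.ker a.toLinearMap) : p v = v := kerProj_coe hab v
  have hq (w : LinearMap.ker c.toLinearMap) : q w = w := kerProj_coe hcd w
  refine ⟨.equivOfInverse (restrictForm e _ _)
    (p.comp ((e.symm : (G →L[ℝ] ℝ) →L[ℝ] F).comp (ContinuousLinearMap.precomp ℝ q)))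
    (fun v => ?_) (fun φ => ?_), rfl⟩
  · have hv : (restrictForm (e : F →L[ℝ] G →L[ℝ] ℝ) _ _ v).comp q = e v :=
      ContinuousLinearMap.ext fun w => (hadj v w).symm.trans (by rw [hp])
    change p (e.symm ((restrictForm (e : F →L[ℝ] G →L[ℝ] ℝ) _ _ v).comp q)) = v
    rw [hv, e.symm_apply_apply, hp]
  · ext w
    change e (p (e.symm (φ.comp q))) w = φ w
    rw [hadj, e.apply_symm_apply, ContinuousLinearMap.comp_apply, hq, hq]

/-- If the first component of an isomorphism `e : F ≃ W × U` has the kernel of `a`, then the second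
component identifies this kernel with `U`. -/
def kerEquivOfEquivProd {W U : Type*} [AddCommGroup W] [Module ℝ W] [TopologicalSpace W]
    [AddCommGroup U] [Module ℝ U] [TopologicalSpace U] (a : F →L[ℝ] G) (e : F ≃L[ℝ] W × U)
    (h : ∀ v, a v = 0 ↔ (e v).1 = 0) : LinearMap.ker a.toLinearMap ≃L[ℝ] U :=
  .equivOfInverse ((ContinuousLinearMap.snd ℝ W U).comp (e.toContinuousLinearMap.comp
      (Submodule.subtypeL _)))
    ((e.symm.toContinuousLinearMap.comp (.inr ℝ W U)).codRestrict _ fun u => by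
      simp [h])
    (fun v => by
      have hv : (e v).1 = 0 := (h v).1 v.2
      have hv' : ((0 : W), (e v).2) = e v := Prod.ext hv.symm rfl
      refine Subtype.ext ?_
      change e.symm (0, (e v).2) = v
      rw [hv', e.symm_apply_apply])
    fun u => by
      change (e (e.symm (0, u))).2 = u
      rw [e.apply_symm_apply]

theorem denseRange_of_semiconj {X H X' H' : Type*} [TopologicalSpace H] [TopologicalSpace H']
    {i : X → H} {i' : X' → H'} {q : X → X'} {p : H → H'} (hi : DenseRange i) (hpc : Continuous p)
    (hp : Function.Surjective p) (h : ∀ u, i' (q u) = p (i u)) : DenseRange i' :=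
  (hp.denseRange.comp hi hpc).mono (range_subset_iff.2 fun u => ⟨q u, h u⟩)

end Kernel

namespace ParaHilbertMor

variable {X₁ H₁ Y₁ X₂ H₂ Y₂ : Type*}
  [AddCommGroup X₁] [Module ℝ X₁] [TopologicalSpace X₁]
  [AddCommGroup H₁] [Module ℝ H₁] [TopologicalSpace H₁]
  [AddCommGroup Y₁] [Module ℝ Y₁] [TopologicalSpace Y₁]
  [AddCommGroup X₂] [Module ℝ X₂] [TopologicalSpace X₂]
  [AddCommGroup H₂] [Module ℝ H₂] [TopologicalSpace H₂]
  [AddCommGroup Y₂] [Module ℝ Y₂] [TopologicalSpace Y₂]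
  {E₁ : ParaHilbertSpace X₁ H₁ Y₁} {E₂ : ParaHilbertSpace X₂ H₂ Y₂} (A : ParaHilbertMor E₁ E₂)

-- `I` determines `J` on the dense range of `j`, so the symmetry of `B A` carries over from `I`.
theorem IsPseudoinverse.J_apply_symm {A : ParaHilbertMor E₁ E₂} {B : ParaHilbertMor E₂ E₁}
    (h : A.IsPseudoinverse B) (u : X₁) (w : Y₁) :
    E₁.J (B.X (A.X u)) w = E₁.J u (B.Y (A.Y w)) := by
  refine E₁.j_dense.induction_on w (isClosed_eq (by fun_prop) (by fun_prop)) fun v => ?_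
  rw [← E₁.comm, ← B.comm_i, ← A.comm_i, h.2.2, A.comm_j, B.comm_j, E₁.comm]

theorem IsSurjective.rightInverse {A : ParaHilbertMor E₁ E₂} (hA : A.IsSurjective)
    {B : ParaHilbertMor E₂ E₁} (hB : A.IsPseudoinverse B) : Function.RightInverse B.X A.X ∧
      Function.RightInverse B.H A.H ∧ Function.RightInverse B.Y A.Y :=
  ⟨hA.1.forall.2 hB.1.1, hA.2.1.forall.2 hB.1.2.2.1, hA.2.2.forall.2 hB.1.2.2.2.2.1⟩

/-- The restriction of the embedding `i` to the kernels of a morphism. -/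
def kerI : LinearMap.ker A.X.toLinearMap →L[ℝ] LinearMap.ker A.H.toLinearMap :=
  (E₁.i.comp (Submodule.subtypeL _)).codRestrict _ fun u => by
    have : A.X u = 0 := u.2
    simp [A.comm_i, this]

/-- The restriction of the embedding `j` to the kernels of a morphism. -/
def kerJ : LinearMap.ker A.H.toLinearMap →L[ℝ] LinearMap.ker A.Y.toLinearMap :=
  (E₁.j.comp (Submodule.subtypeL _)).codRestrict _ fun u => by
    have : A.H u = 0 := u.2
    simp [A.comm_j, this]

variable [IsTopologicalAddGroup X₁] [IsTopologicalAddGroup H₁] [IsTopologicalAddGroup Y₁]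

/-- The kernel of a morphism that has a pseudoinverse, with the restrictions of `i`, `j`, `I` and
`J`. -/
noncomputable def ker (hB : ∃ B, A.IsPseudoinverse B) :
    ParaHilbertSpace (LinearMap.ker A.X.toLinearMap) (LinearMap.ker A.H.toLinearMap)
      (LinearMap.ker A.Y.toLinearMap) where
  i := A.kerI
  j := A.kerJ
  I := restrictForm E₁.I _ _
  J := restrictForm E₁.J _ _
  i_injective := fun u v h => Subtype.ext (E₁.i_injective (congrArg Subtype.val h))
  i_dense := by
    obtain ⟨B, ⟨hX, -, hH, -⟩, -⟩ := hB
    refine denseRange_of_semiconj (q := kerProj A.X B.X hX) E₁.i_dense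
      (kerProj A.H B.H hH).continuous (surjective_kerProj hH) fun u => Subtype.ext ?_
    change E₁.i (u - B.X (A.X u)) = E₁.i u - B.H (A.H (E₁.i u))
    rw [map_sub, A.comm_i, B.comm_i]
  j_injective := fun u v h => Subtype.ext (E₁.j_injective (congrArg Subtype.val h))
  j_dense := by
    obtain ⟨B, ⟨-, -, hH, -, hY, -⟩, -⟩ := hB
    refine denseRange_of_semiconj (q := kerProj A.H B.H hH) E₁.j_dense
      (kerProj A.Y B.Y hY).continuous (surjective_kerProj hY) fun u => Subtype.ext ?_
    change E₁.j (u - B.H (A.H u)) = E₁.j u - B.Y (A.Y (E₁.j u))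
    rw [map_sub, A.comm_j, B.comm_j]
  I_symm := fun v w => E₁.I_symm v w
  I_pos := fun v hv => E₁.I_pos v fun h => hv (Subtype.ext h)
  I_iso := by
    obtain ⟨B, ⟨-, -, hH, -⟩, -, hI⟩ := hB
    exact isInvertible_restrictForm_ker E₁.I_iso hH hH hI
  J_iso := by
    obtain ⟨B, hB⟩ := hB
    exact isInvertible_restrictForm_ker E₁.J_iso hB.1.1 hB.1.2.2.2.2.1 hB.J_apply_symm
  comm := fun u v => E₁.comm u v

end ParaHilbertMor

/-! ### Regular functions, regular charts and differentials on Banach manifolds -/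

section ThroughChart

theorem comp_symm_comp_eventuallyEq {M B V W : Type*} [TopologicalSpace M] [TopologicalSpace B]
    [TopologicalSpace V] (b : OpenPartialHomeomorph M B) (h : M → W) {g : V → M} {p : V}
    (hg : ContinuousAt g p) (hp : g p ∈ b.source) : (h ∘ b.symm) ∘ (b ∘ g) =ᶠ[𝓝 p] h ∘ g := by
  filter_upwards [hg (b.open_source.mem_nhds hp)] with z hz
  exact congrArg h (b.left_inv hz)

variable {M V B W : Type*} [TopologicalSpace M] [NormedAddCommGroup V] [NormedSpace ℝ V]
  [NormedAddCommGroup B] [NormedSpace ℝ B] [NormedAddCommGroup W] [NormedSpace ℝ W]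
  {l : ℕ∞} {α : ℝ≥0} {g : V → M} {p : V} (b : OpenPartialHomeomorph M B)

variable {h : M → W}

theorem CkaAt.comp_of_chart (hα : α ≤ 1) (hg : ContinuousAt g p) (hp : g p ∈ b.source)
    (hh : CkaAt l α (h ∘ b.symm) (b (g p))) (hb : CkaAt l α (b ∘ g) p)
    (hb₁ : ContDiffAt ℝ 1 (b ∘ g) p) : CkaAt l α (h ∘ g) p :=
  (CkaAt.comp hα (f := b ∘ g) hh hb (Or.inr hb₁)).congr (comp_symm_comp_eventuallyEq b h hg hp)

theorem fderiv_comp_of_chart (hg : ContinuousAt g p) (hp : g p ∈ b.source)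
    (hh : DifferentiableAt ℝ (h ∘ b.symm) (b (g p))) (hb : DifferentiableAt ℝ (b ∘ g) p) (v : V) :
    fderiv ℝ (h ∘ g) p v = fderiv ℝ (h ∘ b.symm) (b (g p)) (fderiv ℝ (b ∘ g) p v) := by
  rw [← (comp_symm_comp_eventuallyEq b h hg hp).fderiv_eq, fderiv_comp p hh hb]
  rfl

end ThroughChart

namespace BanachManifold

variable {M : Type u} [TopologicalSpace M] {N : Type v} [TopologicalSpace N] {k l : ℕ∞} {α : ℝ≥0}
  {V W Z : Type*} [NormedAddCommGroup V] [NormedSpace ℝ V] [NormedAddCommGroup W] [NormedSpace ℝ W]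
  [NormedAddCommGroup Z] [NormedSpace ℝ Z]

namespace RegAt

variable {𝔐 : BanachManifold M k α} {x : M}

theorem congr {f g : M → W} (hf : 𝔐.RegAt l f x) (h : f =ᶠ[𝓝 x] g) : 𝔐.RegAt l g x :=
  fun c hc => (hf c hc).congr (((𝔐.chart c).tendsto_symm hc).eventually h)

theorem continuousAt {f : M → W} (hf : 𝔐.RegAt l f x) : ContinuousAt f x := by
  obtain ⟨c, hc⟩ := 𝔐.cover x
  refine (ContinuousAt.comp (f := 𝔐.chart c) (g := f ∘ (𝔐.chart c).symm) (hf c hc).continuousAt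
    ((𝔐.chart c).continuousAt hc)).congr ?_
  filter_upwards [(𝔐.chart c).open_source.mem_nhds hc] with y hy
  exact congrArg f ((𝔐.chart c).left_inv hy)

theorem const (hα : α ≤ 1) (w : W) : 𝔐.RegAt l (fun _ => w) x := fun _ _ => CkaAt.const hα w

theorem continuousLinearMap_comp (hα : α ≤ 1) (L : W →L[ℝ] Z) {f : M → W} (hf : 𝔐.RegAt l f x) :
    𝔐.RegAt l (fun y => L (f y)) x :=
  fun c hc => (hf c hc).continuousLinearMap_comp hα L

theorem clm_comp (hα : α ≤ 1) {S : M → W →L[ℝ] Z} {T : M → V →L[ℝ] W} (hS : 𝔐.RegAt l S x)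
    (hT : 𝔐.RegAt l T x) : 𝔐.RegAt l (fun y => (S y).comp (T y)) x :=
  fun c hc => (hS c hc).clm_comp hα (hT c hc)

theorem clm_prod (hα : α ≤ 1) {S : M → V →L[ℝ] W} {T : M → V →L[ℝ] Z} (hS : 𝔐.RegAt l S x)
    (hT : 𝔐.RegAt l T x) : 𝔐.RegAt l (fun y => (S y).prod (T y)) x :=
  fun c hc => (hS c hc).clm_prod hα (hT c hc)

theorem inverse [CompleteSpace V] (hα : α ≤ 1) {T : M → V →L[ℝ] W} (hT : 𝔐.RegAt l T x)
    (h : (T x).IsInvertible) : 𝔐.RegAt l (fun y => (T y).inverse) x :=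
  fun c hc => (hT c hc).inverse hα (by simpa [(𝔐.chart c).left_inv hc] using h)

theorem precomp (hα : α ≤ 1) {T : M → V →L[ℝ] W} (hT : 𝔐.RegAt l T x) :
    𝔐.RegAt l (fun y => (ContinuousLinearMap.precomp ℝ (T y) : (W →L[ℝ] ℝ) →L[ℝ] V →L[ℝ] ℝ)) x :=
  (hT.continuousLinearMap_comp hα (ContinuousLinearMap.compL ℝ V W ℝ).flip).congr
    (.of_forall fun _ => ContinuousLinearMap.ext fun _ => rfl)

theorem comp_isRegularMap (hα : α ≤ 1) (hk : 1 ≤ k) (hl : l ≤ k) {𝔑 : BanachManifold N k α}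
    {φ : M → N} {f : N → W} (hf : 𝔑.RegAt l f (φ x)) (hφ : 𝔐.IsRegularMap 𝔑 φ) :
    𝔐.RegAt l (fun y => f (φ y)) x := by
  intro c hc
  obtain ⟨d, hd⟩ := 𝔑.cover (φ x)
  have hx : (𝔐.chart c).symm (𝔐.chart c x) = x := (𝔐.chart c).left_inv hc
  have hreg := hφ.2 c d x hc hd
  refine CkaAt.comp_of_chart (h := f) (g := φ ∘ (𝔐.chart c).symm) (𝔑.chart d) hα
    (hφ.1.continuousAt.comp ((𝔐.chart c).continuousAt_symm ((𝔐.chart c).map_source hc)))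
    ?_ ?_ (hreg.mono hα hl) (hreg.contDiffAt_one hk)
  · rwa [Function.comp_apply, hx]
  · rw [Function.comp_apply, hx]
    exact hf d hd

end RegAt

/-- A chart of `M` with values in an arbitrary normed space that is compatible with the atlas. -/
structure IsRegularChart (𝔐 : BanachManifold M k α) (ψ : OpenPartialHomeomorph M V) : Prop where
  regAt : ∀ x ∈ ψ.source, 𝔐.RegAt k ψ x
  ckaAt_symm : ∀ x ∈ ψ.source, ∀ c, x ∈ (𝔐.chart c).source → CkaAt k α (𝔐.chart c ∘ ψ.symm) (ψ x)

variable {𝔐 : BanachManifold M k α} {𝔑 : BanachManifold N k α} {x : M}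

theorem isRegularChart_chart (c : 𝔐.ι) : 𝔐.IsRegularChart (𝔐.chart c) :=
  ⟨fun x hx d hd => 𝔐.compat d c x hd hx, fun x hx d hd => 𝔐.compat c d x hx hd⟩

namespace IsRegularChart

variable {ψ : OpenPartialHomeomorph M V}

theorem regAt_iff (hk : 1 ≤ k) (hα : α ≤ 1) (hl : l ≤ k) (hψ : 𝔐.IsRegularChart ψ)
    (hx : x ∈ ψ.source) {h : M → W} : 𝔐.RegAt l h x ↔ CkaAt l α (h ∘ ψ.symm) (ψ x) := by
  constructor
  · intro hh
    obtain ⟨c, hc⟩ := 𝔐.cover x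
    have hreg := hψ.ckaAt_symm x hx c hc
    have hsymm := ψ.continuousAt_symm (ψ.map_source hx)
    refine CkaAt.comp_of_chart (𝔐.chart c) hα hsymm ?_ ?_ (hreg.mono hα hl) (hreg.contDiffAt_one hk)
    · rwa [ψ.left_inv hx]
    · simpa only [ψ.left_inv hx] using hh c hc
  · intro hh c hc
    have hreg := hψ.regAt x hx c hc
    have hsymm := (𝔐.chart c).continuousAt_symm ((𝔐.chart c).map_source hc)
    refine CkaAt.comp_of_chart ψ hα hsymm ?_ ?_ (hreg.mono hα hl) (hreg.contDiffAt_one hk)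
    · rwa [(𝔐.chart c).left_inv hc]
    · simpa only [(𝔐.chart c).left_inv hc] using hh

theorem trans (hk : 1 ≤ k) (hα : α ≤ 1) (hψ : 𝔐.IsRegularChart ψ) {g : OpenPartialHomeomorph V W}
    (hg : IsCkaDiffeo k α g) : 𝔐.IsRegularChart (ψ.trans g) := by
  refine ⟨fun x hx => ?_, fun x hx c hc => ?_⟩ <;> rw [ψ.trans_source] at hx
  · have hgx := hg.ckaAt (ψ x) hx.2
    refine (hψ.regAt_iff hk hα le_rfl hx.1).2 (hgx.congr ?_)
    filter_upwards [ψ.open_target.mem_nhds (ψ.map_source hx.1)] with z hz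
    exact congrArg g (ψ.right_inv hz).symm
  · have hgx := hg.ckaAt_symm (ψ x) hx.2
    refine CkaAt.comp hα (g := 𝔐.chart c ∘ ψ.symm) (f := g.symm) ?_ hgx
      (Or.inr (hgx.contDiffAt_one hk))
    rw [ψ.coe_trans, Function.comp_apply, g.left_inv hx.2]
    exact hψ.ckaAt_symm x hx.1 c hc

theorem restrOpen (hψ : 𝔐.IsRegularChart ψ) {s : Set M} (hs : IsOpen s) :
    𝔐.IsRegularChart (ψ.restrOpen s hs) :=
  ⟨fun x hx => hψ.regAt x hx.1, fun x hx => hψ.ckaAt_symm x hx.1⟩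

end IsRegularChart

theorem fderiv_dchart {c d : 𝔐.ι} (hc : x ∈ (𝔐.chart c).source) (hd : x ∈ (𝔐.chart d).source)
    (v : 𝔐.TangentSpace x) :
    fderiv ℝ (𝔐.chart d ∘ (𝔐.chart c).symm) (𝔐.chart c x) (𝔐.dchart c x v) = 𝔐.dchart d x v :=
  v.2.2 c d hc hd

theorem tangentSpace_ext {v w : 𝔐.TangentSpace x}
    (h : ∀ c, x ∈ (𝔐.chart c).source → 𝔐.dchart c x v = 𝔐.dchart c x w) : v = w := by
  refine Subtype.ext (funext fun c => ?_)
  by_cases hc : x ∈ (𝔐.chart c).source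
  · exact h c hc
  · rw [v.2.1 c hc, w.2.1 c hc]

/-- The differential at `x` of a function with values in a normed space. It is computed in a chart
around `x`; by `differential_eq` the choice does not matter if the function is regular. -/
noncomputable def differential (𝔐 : BanachManifold M k α) (h : M → W) (x : M) :
    𝔐.TangentSpace x →L[ℝ] W :=
  (fderiv ℝ (h ∘ (𝔐.chart (𝔐.cover x).choose).symm) (𝔐.chart (𝔐.cover x).choose x)).comp
    (𝔐.dchart (𝔐.cover x).choose x)

theorem differential_eq (hk : 1 ≤ k) {c : 𝔐.ι} (hc : x ∈ (𝔐.chart c).source) {h : M → W}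
    (hh : 𝔐.RegAt k h x) (v : 𝔐.TangentSpace x) : 𝔐.differential h x v =
      fderiv ℝ (h ∘ (𝔐.chart c).symm) (𝔐.chart c x) (𝔐.dchart c x v) := by
  have hb := (𝔐.cover x).choose_spec
  set b := (𝔐.cover x).choose
  have hsymm := (𝔐.chart b).continuousAt_symm ((𝔐.chart b).map_source hb)
  have hx := (𝔐.chart b).left_inv hb
  have := fderiv_comp_of_chart (h := h) (𝔐.chart c) hsymm (by rwa [hx])
    (by rw [hx]; exact (hh c hc).differentiableAt hk)
    ((𝔐.compat b c x hb hc).differentiableAt hk) (𝔐.dchart b x v)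
  rwa [fderiv_dchart hb hc, hx] at this

theorem differential_chart (hk : 1 ≤ k) {c : 𝔐.ι} (hc : x ∈ (𝔐.chart c).source) :
    𝔐.differential (𝔐.chart c) x = 𝔐.dchart c x :=
  ContinuousLinearMap.ext fun v => by
    rw [differential_eq hk hc ((isRegularChart_chart c).regAt x hc), fderiv_dchart hc hc]

theorem differential_congr {f h : M → W} (hfh : f =ᶠ[𝓝 x] h) :
    𝔐.differential f x = 𝔐.differential h x := by
  have hb := (𝔐.cover x).choose_spec
  have h : f ∘ (𝔐.chart _).symm =ᶠ[𝓝 _] h ∘ (𝔐.chart _).symm :=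
    ((𝔐.chart _).tendsto_symm hb).eventually hfh
  rw [differential, h.fderiv_eq]
  rfl

theorem differential_continuousLinearMap_comp (hk : 1 ≤ k) (L : W →L[ℝ] Z) {h : M → W}
    (hh : 𝔐.RegAt k h x) (v : 𝔐.TangentSpace x) :
    𝔐.differential (L ∘ h) x v = L (𝔐.differential h x v) := by
  have hd := (hh _ (𝔐.cover x).choose_spec).differentiableAt hk
  simp only [differential, Function.comp_assoc, ContinuousLinearMap.comp_apply]
  rw [fderiv_comp _ L.differentiableAt hd, L.fderiv]
  rfl

namespace IsRegularChart

variable {ψ : OpenPartialHomeomorph M V}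

theorem fderiv_comp_symm_differential (hk : 1 ≤ k) (hα : α ≤ 1) (hψ : 𝔐.IsRegularChart ψ)
    (hx : x ∈ ψ.source) {h : M → W} (hh : 𝔐.RegAt k h x) (v : 𝔐.TangentSpace x) :
    fderiv ℝ (h ∘ ψ.symm) (ψ x) (𝔐.differential ψ x v) = 𝔐.differential h x v := by
  obtain ⟨c, hc⟩ := 𝔐.cover x
  have hreg := hψ.regAt x hx
  have hsymm := (𝔐.chart c).continuousAt_symm ((𝔐.chart c).map_source hc)
  have hcx := (𝔐.chart c).left_inv hc
  have := fderiv_comp_of_chart (h := h) ψ hsymm (by rwa [hcx])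
    (by rw [hcx]; exact ((hψ.regAt_iff hk hα le_rfl hx).1 hh).differentiableAt hk)
    ((hreg c hc).differentiableAt hk) (𝔐.dchart c x v)
  rw [differential_eq hk hc hreg, differential_eq hk hc hh, this, hcx]

open Classical in
/-- The tangent vector at `x` that is represented by a given vector in the regular chart `ψ`. -/
noncomputable def tangentVector (hk : 1 ≤ k) (hψ : 𝔐.IsRegularChart ψ) (hx : x ∈ ψ.source) :
    V →L[ℝ] 𝔐.TangentSpace x :=
  (ContinuousLinearMap.pi fun c => if x ∈ (𝔐.chart c).source
    then fderiv ℝ (𝔐.chart c ∘ ψ.symm) (ψ x) else 0).codRestrict _ fun v => by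
      refine ⟨fun c hc => by simp [hc], fun c d hc hd => ?_⟩
      simp only [ContinuousLinearMap.coe_pi', if_pos hc, if_pos hd]
      have hψx := ψ.left_inv hx
      have := fderiv_comp_of_chart (h := 𝔐.chart d) (𝔐.chart c)
        (ψ.continuousAt_symm (ψ.map_source hx)) (by rwa [hψx])
        (by rw [hψx]; exact (𝔐.compat c d x hc hd).differentiableAt hk)
        ((hψ.ckaAt_symm x hx c hc).differentiableAt hk) v
      rw [this, hψx]

theorem dchart_tangentVector (hk : 1 ≤ k) (hψ : 𝔐.IsRegularChart ψ) (hx : x ∈ ψ.source) {c : 𝔐.ι}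
    (hc : x ∈ (𝔐.chart c).source) (v : V) :
    𝔐.dchart c x (hψ.tangentVector hk hx v) = fderiv ℝ (𝔐.chart c ∘ ψ.symm) (ψ x) v := by
  classical
  change (if x ∈ (𝔐.chart c).source then fderiv ℝ (𝔐.chart c ∘ ψ.symm) (ψ x) else 0) v = _
  rw [if_pos hc]

theorem differential_tangentVector (hk : 1 ≤ k) (hψ : 𝔐.IsRegularChart ψ) (hx : x ∈ ψ.source)
    (v : V) : 𝔐.differential ψ x (hψ.tangentVector hk hx v) = v := by
  obtain ⟨c, hc⟩ := 𝔐.cover x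
  have hψx := ψ.left_inv hx
  have hid : ψ ∘ ψ.symm =ᶠ[𝓝 (ψ x)] id := by
    filter_upwards [ψ.open_target.mem_nhds (ψ.map_source hx)] with z hz using ψ.right_inv hz
  have := fderiv_comp_of_chart (h := ψ) (𝔐.chart c)
    (ψ.continuousAt_symm (ψ.map_source hx)) (by rwa [hψx])
    (by rw [hψx]; exact (hψ.regAt x hx c hc).differentiableAt hk)
    ((hψ.ckaAt_symm x hx c hc).differentiableAt hk) v
  rw [hid.fderiv_eq, fderiv_id, hψx] at this
  rw [differential_eq hk hc (hψ.regAt x hx), dchart_tangentVector hk hψ hx hc, ← this,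
    ContinuousLinearMap.id_apply]

/-- The differential of a regular chart as an isomorphism. -/
noncomputable def differentialEquiv (hk : 1 ≤ k) (hα : α ≤ 1) (hψ : 𝔐.IsRegularChart ψ)
    (hx : x ∈ ψ.source) : 𝔐.TangentSpace x ≃L[ℝ] V :=
  .equivOfInverse (𝔐.differential ψ x) (hψ.tangentVector hk hx)
    (fun v => tangentSpace_ext fun c hc => by
      rw [hψ.dchart_tangentVector hk hx hc, hψ.fderiv_comp_symm_differential hk hα hx
        ((isRegularChart_chart c).regAt x hc), differential_chart hk hc])
    (hψ.differential_tangentVector hk hx)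

end IsRegularChart

namespace IsRegularMap

variable {φ : M → N}

theorem regAt_chart_comp (hφ : 𝔐.IsRegularMap 𝔑 φ) {d : 𝔑.ι} (hd : φ x ∈ (𝔑.chart d).source) :
    𝔐.RegAt k (𝔑.chart d ∘ φ) x :=
  fun c hc => hφ.2 c d x hc hd

theorem isTangentImage_iff (hk : 1 ≤ k) (hφ : 𝔐.IsRegularMap 𝔑 φ) {v : 𝔐.TangentSpace x}
    {w : 𝔑.TangentSpace (φ x)} : 𝔐.IsTangentImage 𝔑 φ x v w ↔
      ∀ d, φ x ∈ (𝔑.chart d).source → 𝔐.differential (𝔑.chart d ∘ φ) x v = 𝔑.dchart d (φ x) w := by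
  refine ⟨fun h d hd => h _ d (𝔐.cover x).choose_spec hd, fun h c d hc hd => ?_⟩
  rw [← h d hd, differential_eq hk hc (hφ.regAt_chart_comp hd), Function.comp_assoc]

theorem differential_comp (hk : 1 ≤ k) (hφ : 𝔐.IsRegularMap 𝔑 φ) {v : 𝔐.TangentSpace x}
    {w : 𝔑.TangentSpace (φ x)} (hvw : 𝔐.IsTangentImage 𝔑 φ x v w) {h : N → W}
    (hh : 𝔑.RegAt k h (φ x)) : 𝔐.differential (h ∘ φ) x v = 𝔑.differential h (φ x) w := by
  obtain ⟨d, hd⟩ := 𝔑.cover (φ x)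
  have hb := (𝔐.cover x).choose_spec
  set b := (𝔐.cover x).choose
  have hx := (𝔐.chart b).left_inv hb
  have hcont := hφ.1.continuousAt.comp
    ((𝔐.chart b).continuousAt_symm ((𝔐.chart b).map_source hb))
  have := fderiv_comp_of_chart (h := h) (𝔑.chart d) hcont (by rwa [Function.comp_apply, hx])
    (by rw [Function.comp_apply, hx]; exact (hh d hd).differentiableAt hk)
    ((hφ.2 b d x hb hd).differentiableAt hk) (𝔐.dchart b x v)
  rwa [hvw b d hb hd, Function.comp_apply, hx, ← differential_eq hk hd hh] at this

end IsRegularMap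

theorem RegAt.fderiv_comp_symm (hk : 1 ≤ k) {c : 𝔐.ι} {h : M → W} (hα : α ≤ 1)
    (hc : x ∈ (𝔐.chart c).source) (hh : 𝔐.RegAt k h x) :
    𝔐.RegAt (k - 1) (fun y => fderiv ℝ (h ∘ (𝔐.chart c).symm) (𝔐.chart c y)) x := by
  refine ((isRegularChart_chart c).regAt_iff hk hα tsub_le_self hc).2 ?_
  refine ((hh c hc).fderiv hk).congr ?_
  filter_upwards [(𝔐.chart c).open_target.mem_nhds ((𝔐.chart c).map_source hc)] with z hz
  rw [Function.comp_apply, (𝔐.chart c).right_inv hz]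

end BanachManifold

namespace BanachBundle

variable {M : Type u} [TopologicalSpace M] {k l : ℕ∞} {α : ℝ≥0} {𝔐 : BanachManifold M k α}
  {F : M → Type u} [∀ x, AddCommGroup (F x)] [∀ x, Module ℝ (F x)] [∀ x, TopologicalSpace (F x)]

theorem triv_eq_zero_iff (B : BanachBundle 𝔐 l F) {i : B.ι} {x : M} (hx : x ∈ B.baseSet i)
    {v : F x} : B.triv i x v = 0 ↔ v = 0 :=
  ⟨fun h => by rw [← B.left_inv i x hx v, h, map_zero], fun h => by rw [h, map_zero]⟩

theorem isTopologicalAddGroup (B : BanachBundle 𝔐 l F) (x : M) : IsTopologicalAddGroup (F x) := by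
  obtain ⟨i, hi⟩ := B.cover x
  let e : F x ≃L[ℝ] B.V i := .equivOfInverse (B.triv i x) (B.trivInv i x)
    (B.left_inv i x hi) (B.right_inv i x hi)
  exact e.toHomeomorph.isInducing.topologicalAddGroup e

theorem IsMorphismToTangent.regAt_differential_comp (hk : 1 ≤ k) (hα : α ≤ 1)
    {B : BanachBundle 𝔐 (k - 1) F} {τ : ∀ x, F x →L[ℝ] 𝔐.TangentSpace x}
    (hτ : B.IsMorphismToTangent τ) {W : Type*} [NormedAddCommGroup W] [NormedSpace ℝ W] {h : M → W}
    {x : M} (hh : ∀ᶠ y in 𝓝 x, 𝔐.RegAt k h y) {i : B.ι} (hx : x ∈ B.baseSet i) :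
    𝔐.RegAt (k - 1) (fun y => ((𝔐.differential h y).comp (τ y)).comp (B.trivInv i y)) x := by
  obtain ⟨c, hc⟩ := 𝔐.cover x
  refine ((hh.self_of_nhds.fderiv_comp_symm hk hα hc).clm_comp hα (hτ i c x hx hc)).congr ?_
  filter_upwards [hh, (𝔐.chart c).open_source.mem_nhds hc] with y hy hyc
  exact ContinuousLinearMap.ext fun v =>
    (BanachManifold.differential_eq hk hyc hy (τ y (B.trivInv i y v))).symm

end BanachBundle

/-! ### Level sets of submersions -/

section Slice

variable {M W U : Type*} [TopologicalSpace M] [TopologicalSpace W] [TopologicalSpace U]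
  (ψ : OpenPartialHomeomorph M (W × U)) {w₀ : W} {p : M → Prop}
  (hp : ∀ x ∈ ψ.source, p x ↔ (ψ x).1 = w₀) (x₀ : {x // p x})

open Classical in
/-- The chart of the subspace `{x // p x}` that is induced by a chart `ψ` in which this subspace is
the slice `{w₀} × U`. The point `x₀` only serves as a value of the inverse outside the target. -/
noncomputable def sliceChart : OpenPartialHomeomorph {x // p x} U where
  toFun x := (ψ x).2
  invFun u := if h : p (ψ.symm (w₀, u)) then ⟨ψ.symm (w₀, u), h⟩ else x₀
  source := Subtype.val ⁻¹' ψ.source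
  target := Prod.mk w₀ ⁻¹' ψ.target
  map_source' x hx := by
    have hx' : (w₀, (ψ x).2) = ψ x := Prod.ext ((hp x hx).1 x.2).symm rfl
    rw [mem_preimage, hx']
    exact ψ.map_source hx
  map_target' u hu := by
    have hs := ψ.map_target hu
    have hu' : p (ψ.symm (w₀, u)) := (hp _ hs).2 (by rw [ψ.right_inv hu])
    rwa [mem_preimage, dif_pos hu']
  left_inv' x hx := by
    have hx' : ψ.symm (w₀, (ψ x).2) = x := by
      rw [← (hp x hx).1 x.2]
      exact ψ.left_inv hx
    exact Subtype.ext (by rw [dif_pos (by rw [hx']; exact x.2)]; exact hx')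
  right_inv' u hu := by
    have hu' : p (ψ.symm (w₀, u)) := (hp _ (ψ.map_target hu)).2 (by rw [ψ.right_inv hu])
    rw [dif_pos hu', ψ.right_inv hu]
  open_source := ψ.open_source.preimage continuous_subtype_val
  open_target := ψ.open_target.preimage (by fun_prop)
  continuousOn_toFun := continuous_snd.comp_continuousOn
    (ψ.continuousOn.comp continuous_subtype_val.continuousOn fun _ hx => hx)
  continuousOn_invFun := by
    have hcont : ContinuousOn (fun u => ψ.symm (w₀, u)) (Prod.mk w₀ ⁻¹' ψ.target) :=
      ψ.continuousOn_symm.comp (by fun_prop) fun _ hu => hu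
    refine Topology.IsInducing.subtypeVal.continuousOn_iff.2 (hcont.congr fun u hu => ?_)
    have hu' : p (ψ.symm (w₀, u)) := (hp _ (ψ.map_target hu)).2 (by rw [ψ.right_inv hu])
    rw [Function.comp_apply, dif_pos hu']

theorem coe_sliceChart_symm {u : U} (hu : (w₀, u) ∈ ψ.target) :
    ((sliceChart ψ hp x₀).symm u : M) = ψ.symm (w₀, u) := by
  classical
  have hu' : p (ψ.symm (w₀, u)) := (hp _ (ψ.map_target hu)).2 (by rw [ψ.right_inv hu])
  change (dite _ _ _ : {x // p x}).1 = _
  rw [dif_pos hu']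

theorem comp_sliceChart_symm_eventuallyEq {Z : Type*} (h : M → Z) {x : {x // p x}}
    (hx : x.1 ∈ ψ.source) : h ∘ Subtype.val ∘ (sliceChart ψ hp x₀).symm =ᶠ[𝓝 (ψ x).2]
      (h ∘ ψ.symm) ∘ Prod.mk w₀ := by
  filter_upwards [(sliceChart ψ hp x₀).open_target.mem_nhds
    ((sliceChart ψ hp x₀).map_source hx)] with u hu
  exact congrArg h (coe_sliceChart_symm ψ hp x₀ hu)

end Slice

namespace BanachManifold

variable {M : Type u} [TopologicalSpace M] {N : Type v} [TopologicalSpace N] {k l : ℕ∞} {α : ℝ≥0}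
  {𝔐 : BanachManifold M k α} {𝔑 : BanachManifold N k α} {Φ : M → N} {y₀ : N}

/-- A submersion chart of `Φ`: a regular chart of `M` with values in a product, in which `Φ`, read
in the chart `d` of `N`, is the first projection. -/
structure SubmersionChart (𝔐 : BanachManifold M k α) (𝔑 : BanachManifold N k α) (Φ : M → N) where
  d : 𝔑.ι
  U : Type u
  [normed : NormedAddCommGroup U]
  [space : NormedSpace ℝ U]
  [complete : CompleteSpace U]
  ψ : OpenPartialHomeomorph M (𝔑.V d × U)
  isRegularChart : 𝔐.IsRegularChart ψ
  maps_source : ∀ x ∈ ψ.source, Φ x ∈ (𝔑.chart d).source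
  fst_eq : ∀ x ∈ ψ.source, (ψ x).1 = 𝔑.chart d (Φ x)

attribute [instance] SubmersionChart.normed SubmersionChart.space SubmersionChart.complete

/-- `Φ` has a submersion chart around `x`, that is, `Φ` is a submersion near `x` with split kernel
of the differential. -/
def IsSubmersionAt (𝔐 : BanachManifold M k α) (𝔑 : BanachManifold N k α) (Φ : M → N)
    (x : M) : Prop :=
  ∃ c : SubmersionChart 𝔐 𝔑 Φ, x ∈ c.ψ.source

theorem IsRegularMap.isSubmersionAt (hk : 1 ≤ k) (hα : α ≤ 1) (hΦ : 𝔐.IsRegularMap 𝔑 Φ) {x : M}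
    {d : 𝔑.ι} (hd : Φ x ∈ (𝔑.chart d).source) {R : 𝔑.V d →L[ℝ] 𝔐.TangentSpace x}
    (hR : Function.RightInverse R (𝔐.differential (𝔑.chart d ∘ Φ) x)) :
    𝔐.IsSubmersionAt 𝔑 Φ x := by
  obtain ⟨e, he⟩ := 𝔐.cover x
  let s := Φ ⁻¹' (𝔑.chart d).source
  have hs : IsOpen s := (𝔑.chart d).open_source.preimage hΦ.1
  let f := (𝔑.chart d ∘ Φ) ∘ (𝔐.chart e).symm
  have hf : ∀ᶠ z in 𝓝 (𝔐.chart e x), CkaAt k α f z := by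
    filter_upwards [(𝔐.chart e).open_target.mem_nhds ((𝔐.chart e).map_source he),
      (𝔐.chart e).tendsto_symm he (hs.mem_nhds hd)] with z hz hzs
    simpa only [(𝔐.chart e).right_inv hz] using
      hΦ.regAt_chart_comp hzs e ((𝔐.chart e).map_target hz)
  obtain ⟨g, hxg, hgf, hg⟩ := exists_isCkaDiffeo_fst_eq hk hα hf ((𝔐.dchart e x).comp R) fun w =>
    (differential_eq hk he (hΦ.regAt_chart_comp hd) (R w)).symm.trans (hR w)
  have hsource : (((𝔐.chart e).restrOpen s hs).trans g).source =
      ((𝔐.chart e).source ∩ s) ∩ 𝔐.chart e ⁻¹' g.source := rfl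
  refine ⟨{
    d := d
    U := (fderiv ℝ f (𝔐.chart e x)).ker
    ψ := ((𝔐.chart e).restrOpen s hs).trans g
    isRegularChart := ((isRegularChart_chart e).restrOpen hs).trans hk hα hg
    maps_source := fun y hy => (hsource ▸ hy).1.2
    fst_eq := fun y hy => ?_ }, ⟨he, hd⟩, hxg⟩
  refine (hgf _).trans (congrArg (𝔑.chart d ∘ Φ) ((𝔐.chart e).left_inv ?_))
  exact (hsource ▸ hy).1.1

namespace SubmersionChart

variable (c : SubmersionChart 𝔐 𝔑 Φ)

theorem differential_fst (hk : 1 ≤ k) (hΦ : 𝔐.IsRegularMap 𝔑 Φ) {x : M} (hx : x ∈ c.ψ.source)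
    {v : 𝔐.TangentSpace x} {w : 𝔑.TangentSpace (Φ x)} (hvw : 𝔐.IsTangentImage 𝔑 Φ x v w) :
    (𝔐.differential c.ψ x v).1 = 𝔑.dchart c.d (Φ x) w := by
  have hfst : ContinuousLinearMap.fst ℝ (𝔑.V c.d) c.U ∘ c.ψ =ᶠ[𝓝 x] 𝔑.chart c.d ∘ Φ := by
    filter_upwards [c.ψ.open_source.mem_nhds hx] with y hy using c.fst_eq y hy
  rw [← (hΦ.isTangentImage_iff hk).1 hvw c.d (c.maps_source x hx), ← differential_congr hfst,
    differential_continuousLinearMap_comp hk _ (c.isRegularChart.regAt x hx)]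
  rfl

theorem regAt_snd (hα : α ≤ 1) {x : M} (hx : x ∈ c.ψ.source) :
    𝔐.RegAt k (fun y => (c.ψ y).2) x :=
  (c.isRegularChart.regAt x hx).continuousLinearMap_comp hα (.snd ℝ (𝔑.V c.d) c.U)

theorem mem_levelSet_iff {x₀ x : M} (hx₀ : x₀ ∈ c.ψ.source) (h : Φ x₀ = y₀)
    (hx : x ∈ c.ψ.source) : Φ x = y₀ ↔ (c.ψ x).1 = 𝔑.chart c.d y₀ := by
  rw [c.fst_eq x hx, ← h]
  exact ((𝔑.chart c.d).injOn.eq_iff (c.maps_source x hx) (c.maps_source x₀ hx₀)).symm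

/-- The chart of the level set of `Φ` through `x₀` induced by a submersion chart around `x₀`. -/
noncomputable def slice (x₀ : {x // Φ x = y₀}) (hx₀ : x₀.1 ∈ c.ψ.source) :
    OpenPartialHomeomorph {x // Φ x = y₀} c.U :=
  sliceChart c.ψ (fun _ => c.mem_levelSet_iff hx₀ x₀.2) x₀

variable {c} {x₀ x : {x // Φ x = y₀}} (hx₀ : x₀.1 ∈ c.ψ.source) (hx : x.1 ∈ c.ψ.source)
  {W : Type*} [NormedAddCommGroup W] [NormedSpace ℝ W] {h : M → W}

include hx

theorem mk_snd : (𝔑.chart c.d y₀, (c.ψ x).2) = c.ψ x :=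
  Prod.ext ((c.mem_levelSet_iff hx x.2 hx).1 x.2).symm rfl

theorem ckaAt_comp_slice_symm (hk : 1 ≤ k) (hα : α ≤ 1) (hh : 𝔐.RegAt k h x) :
    CkaAt k α (h ∘ Subtype.val ∘ (c.slice x₀ hx₀).symm) (c.slice x₀ hx₀ x) := by
  have hh' := (c.isRegularChart.regAt_iff hk hα le_rfl hx).1 hh
  rw [← mk_snd hx] at hh'
  refine (CkaAt.comp hα hh' ?_ (Or.inr ?_)).congr
    (comp_sliceChart_symm_eventuallyEq c.ψ _ x₀ h hx).symm
  · exact CkaAt.of_contDiff hα fun _ => contDiff_prodMk_right _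
  · exact (contDiff_prodMk_right _).contDiffAt

theorem fderiv_comp_slice_symm (hk : 1 ≤ k) (hα : α ≤ 1) (hh : 𝔐.RegAt k h x) (u : c.U) :
    fderiv ℝ (h ∘ Subtype.val ∘ (c.slice x₀ hx₀).symm) (c.slice x₀ hx₀ x) u =
      fderiv ℝ (h ∘ c.ψ.symm) (c.ψ x) (0, u) := by
  have hh' := ((c.isRegularChart.regAt_iff hk hα le_rfl hx).1 hh).differentiableAt hk
  rw [← mk_snd hx] at hh' ⊢
  have hd := (hh'.hasFDerivAt.comp (c.ψ x).2 (hasFDerivAt_prodMk_right _ _)).congr_of_eventuallyEq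
    (comp_sliceChart_symm_eventuallyEq c.ψ (fun _ => c.mem_levelSet_iff hx₀ x₀.2) x₀ h hx)
  exact DFunLike.congr_fun hd.fderiv u

end SubmersionChart

/-- A chosen submersion chart around `x`. -/
noncomputable def IsSubmersionAt.chart {x : M} (h : 𝔐.IsSubmersionAt 𝔑 Φ x) :
    SubmersionChart 𝔐 𝔑 Φ :=
  h.choose

theorem IsSubmersionAt.mem_source {x : M} (h : 𝔐.IsSubmersionAt 𝔑 Φ x) : x ∈ h.chart.ψ.source :=
  h.choose_spec

/-- The level set of a map that is a submersion along it, with the slices of submersion charts as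
charts. -/
noncomputable abbrev levelSet (hk : 1 ≤ k) (hα : α ≤ 1)
    (h : ∀ x, Φ x = y₀ → 𝔐.IsSubmersionAt 𝔑 Φ x) : BanachManifold {x // Φ x = y₀} k α where
  ι := {x // Φ x = y₀}
  V a := (h a a.2).chart.U
  chart a := (h a a.2).chart.slice a (h a a.2).mem_source
  cover x := ⟨x, (h x x.2).mem_source⟩
  compat a b _ ha hb := SubmersionChart.ckaAt_comp_slice_symm (h a a.2).mem_source ha hk hα
    ((h b b.2).chart.regAt_snd hα hb)

section LevelSet

variable (hk : 1 ≤ k) (hα : α ≤ 1) (h : ∀ x, Φ x = y₀ → 𝔐.IsSubmersionAt 𝔑 Φ x)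

theorem isRegularMap_levelSet_val : (levelSet hk hα h).IsRegularMap 𝔐 Subtype.val :=
  ⟨continuous_subtype_val, fun a d x ha hd => SubmersionChart.ckaAt_comp_slice_symm
    (h a.1 a.2).mem_source ha hk hα ((isRegularChart_chart d).regAt x hd)⟩

/-- The differential at `x` of the slice chart around `x` as an isomorphism. -/
noncomputable def levelSetTangentEquiv (x : {x // Φ x = y₀}) :
    (levelSet hk hα h).TangentSpace x ≃L[ℝ] (h x x.2).chart.U :=
  (isRegularChart_chart (𝔐 := levelSet hk hα h) x).differentialEquiv hk hα (h x x.2).mem_source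

theorem isTangentImage_levelSet_val {x : {x // Φ x = y₀}} {v : (levelSet hk hα h).TangentSpace x}
    {w : 𝔐.TangentSpace x.1}
    (hvw : 𝔐.differential (h x x.2).chart.ψ x w = (0, levelSetTangentEquiv hk hα h x v)) :
    (levelSet hk hα h).IsTangentImage 𝔐 Subtype.val x v w := by
  have hφ := isRegularMap_levelSet_val hk hα h
  have hx := (h x x.2).mem_source
  refine (hφ.isTangentImage_iff hk).2 fun d hd => ?_
  have hreg := (isRegularChart_chart d).regAt x.1 hd
  have hslice := (isRegularChart_chart (𝔐 := levelSet hk hα h) x).fderiv_comp_symm_differential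
    hk hα hx (hφ.regAt_chart_comp hd) v
  rw [← hslice, ← differential_chart hk hd,
    ← (h x x.2).chart.isRegularChart.fderiv_comp_symm_differential hk hα hx hreg, hvw]
  exact SubmersionChart.fderiv_comp_slice_symm hx hx hk hα hreg _

theorem differential_levelSet_chart {a x : {x // Φ x = y₀}}
    (ha : x.1 ∈ (h a a.2).chart.ψ.source) {v : (levelSet hk hα h).TangentSpace x}
    {w : 𝔐.TangentSpace x.1}
    (hvw : (levelSet hk hα h).IsTangentImage 𝔐 Subtype.val x v w) :
    (levelSet hk hα h).differential ((levelSet hk hα h).chart a) x v =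
      𝔐.differential (fun y => ((h a a.2).chart.ψ y).2) x w :=
  (isRegularMap_levelSet_val hk hα h).differential_comp hk hvw ((h a a.2).chart.regAt_snd hα ha)

end LevelSet

end BanachManifold

/-! ### Subbundles of pullbacks of Banach bundles -/

/-- A local trivialization, over an open set of the manifold `𝔐₀` mapped to `𝔐` by `φ`, of a family
`S` of subspaces of the fibres of the bundle `B` over `𝔐`: in the trivialization `i` of `B`, the
subspaces are the images of the operators `R y`, which have a common left inverse `Q`. -/
structure SubbundleTriv {M₀ M : Type u} [TopologicalSpace M₀] [TopologicalSpace M] {k l : ℕ∞}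
    {α : ℝ≥0} (𝔐₀ : BanachManifold M₀ k α) {𝔐 : BanachManifold M k α} {F : M → Type u}
    [∀ x, AddCommGroup (F x)] [∀ x, Module ℝ (F x)] [∀ x, TopologicalSpace (F x)]
    (B : BanachBundle 𝔐 l F) (φ : M₀ → M) (S : ∀ y, Submodule ℝ (F (φ y))) where
  i : B.ι
  W : Type u
  [normed : NormedAddCommGroup W]
  [space : NormedSpace ℝ W]
  [complete : CompleteSpace W]
  baseSet : Set M₀
  isOpen_baseSet : IsOpen baseSet
  maps_baseSet : ∀ y ∈ baseSet, φ y ∈ B.baseSet i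
  Q : B.V i →L[ℝ] W
  R : M₀ → W →L[ℝ] B.V i
  regAt_R : ∀ y ∈ baseSet, 𝔐₀.RegAt l R y
  R_mem : ∀ y ∈ baseSet, ∀ w, B.trivInv i (φ y) (R y w) ∈ S y
  Q_R : ∀ y ∈ baseSet, ∀ w, Q (R y w) = w
  R_Q : ∀ y ∈ baseSet, ∀ v ∈ S y, R y (Q (B.triv i (φ y) v)) = B.triv i (φ y) v

attribute [instance] SubbundleTriv.normed SubbundleTriv.space SubbundleTriv.complete

section Subbundle

variable {M₀ M : Type u} [TopologicalSpace M₀] [TopologicalSpace M] {k l : ℕ∞} {α : ℝ≥0}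
  {𝔐₀ : BanachManifold M₀ k α} {𝔐 : BanachManifold M k α} {F : M → Type u}
  [∀ x, AddCommGroup (F x)] [∀ x, Module ℝ (F x)] [∀ x, TopologicalSpace (F x)]
  {B : BanachBundle 𝔐 l F} {φ : M₀ → M} {S : ∀ y, Submodule ℝ (F (φ y))}

namespace SubbundleTriv

variable (t : SubbundleTriv 𝔐₀ B φ S)

/-- The local trivialization of the subspaces. -/
def triv (y : M₀) : S y →L[ℝ] t.W :=
  (t.Q.comp (B.triv t.i (φ y))).comp (S y).subtypeL

open Classical in
/-- The inverse of the local trivialization of the subspaces. -/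
noncomputable def trivInv (y : M₀) : t.W →L[ℝ] S y :=
  if h : y ∈ t.baseSet then
    ((B.trivInv t.i (φ y)).comp (t.R y)).codRestrict _ (t.R_mem y h)
  else 0

theorem subtypeL_comp_trivInv {y : M₀} (hy : y ∈ t.baseSet) :
    (S y).subtypeL.comp (t.trivInv y) = (B.trivInv t.i (φ y)).comp (t.R y) := by
  rw [trivInv, dif_pos hy]
  rfl

theorem coe_trivInv {y : M₀} (hy : y ∈ t.baseSet) (w : t.W) :
    (t.trivInv y w : F (φ y)) = B.trivInv t.i (φ y) (t.R y w) :=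
  DFunLike.congr_fun (t.subtypeL_comp_trivInv hy) w

theorem eventually_mem_baseSet {y : M₀} (hy : y ∈ t.baseSet) : ∀ᶠ z in 𝓝 y, z ∈ t.baseSet :=
  t.isOpen_baseSet.mem_nhds hy

end SubbundleTriv

/-- The subspaces `S y` of the fibres `F (φ y)` form a split subbundle of the pullback of `B` by
`φ`. -/
def IsSubbundle (𝔐₀ : BanachManifold M₀ k α) (B : BanachBundle 𝔐 l F) (φ : M₀ → M)
    (S : ∀ y, Submodule ℝ (F (φ y))) : Prop :=
  ∀ y, ∃ t : SubbundleTriv 𝔐₀ B φ S, y ∈ t.baseSet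

namespace IsSubbundle

/-- A chosen local trivialization around `y`. -/
noncomputable def localTriv (hS : IsSubbundle 𝔐₀ B φ S) (y : M₀) : SubbundleTriv 𝔐₀ B φ S :=
  (hS y).choose

theorem mem_baseSet_localTriv (hS : IsSubbundle 𝔐₀ B φ S) (y : M₀) :
    y ∈ (hS.localTriv y).baseSet :=
  (hS y).choose_spec

variable (hk : 1 ≤ k) (hα : α ≤ 1) (hl : l ≤ k) (hφ : 𝔐₀.IsRegularMap 𝔐 φ)
  (hS : IsSubbundle 𝔐₀ B φ S)

/-- A split subbundle as a Banach bundle. -/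
noncomputable def bundle : BanachBundle 𝔐₀ l fun y => S y where
  ι := M₀
  V a := (hS.localTriv a).W
  baseSet a := (hS.localTriv a).baseSet
  isOpen_baseSet a := (hS.localTriv a).isOpen_baseSet
  cover y := ⟨y, hS.mem_baseSet_localTriv y⟩
  triv a y := (hS.localTriv a).triv y
  trivInv a y := (hS.localTriv a).trivInv y
  left_inv a y hy v := by
    let t := hS.localTriv a
    refine Subtype.ext ((t.coe_trivInv hy _).trans ?_)
    change B.trivInv _ _ (t.R y (t.Q (B.triv _ _ v.1))) = _
    rw [t.R_Q y hy v v.2, B.left_inv _ _ (t.maps_baseSet y hy)]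
  right_inv a y hy w := by
    let t := hS.localTriv a
    change t.Q (B.triv _ _ (t.trivInv y w : F (φ y))) = w
    rw [t.coe_trivInv hy, B.right_inv _ _ (t.maps_baseSet y hy), t.Q_R y hy]
  compat a b y ha hb := by
    let t := hS.localTriv a
    let s := hS.localTriv b
    have hB := (B.compat t.i s.i (φ y) (t.maps_baseSet y ha) (s.maps_baseSet y hb)
      ).comp_isRegularMap hα hk hl hφ
    refine ((hB.clm_comp hα (t.regAt_R y ha)).continuousLinearMap_comp hα
      (ContinuousLinearMap.compL ℝ _ _ _ s.Q)).congr ?_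
    filter_upwards [t.eventually_mem_baseSet ha] with z hz
    ext w
    exact congrArg (fun v => s.Q (B.triv s.i (φ z) v)) (t.coe_trivInv hz w).symm

theorem isMorphismOver_subtypeL :
    (hS.bundle hk hα hl hφ).IsMorphismOver B φ fun y => (S y).subtypeL := by
  intro a j y ha hj
  let t := hS.localTriv a
  have hB := (B.compat t.i j (φ y) (t.maps_baseSet y ha) hj).comp_isRegularMap hα hk hl hφ
  refine (hB.clm_comp hα (t.regAt_R y ha)).congr ?_
  filter_upwards [t.eventually_mem_baseSet ha] with z hz
  ext w
  exact congrArg (B.triv j (φ z)) (t.coe_trivInv hz w).symm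

variable {G : M → Type u} [∀ x, AddCommGroup (G x)] [∀ x, Module ℝ (G x)]
  [∀ x, TopologicalSpace (G x)] {B' : BanachBundle 𝔐 l G} {S' : ∀ y, Submodule ℝ (G (φ y))}
  (hS' : IsSubbundle 𝔐₀ B' φ S')

theorem isMorphism_of_coe_eq {T : ∀ x, F x →L[ℝ] G x} (hT : B.IsMorphism B' T)
    {T₀ : ∀ y, S y →L[ℝ] S' y} (hT₀ : ∀ y v, (T₀ y v : G (φ y)) = T (φ y) v) :
    (hS.bundle hk hα hl hφ).IsMorphism (hS'.bundle hk hα hl hφ) T₀ := by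
  intro a b y ha hb
  let t := hS.localTriv a
  let t' := hS'.localTriv b
  have h := (hT t.i t'.i (φ y) (t.maps_baseSet y ha) (t'.maps_baseSet y hb)).comp_isRegularMap
    hα hk hl hφ
  refine ((h.clm_comp hα (t.regAt_R y ha)).continuousLinearMap_comp hα
    (ContinuousLinearMap.compL ℝ _ _ _ t'.Q)).congr ?_
  filter_upwards [t.eventually_mem_baseSet ha] with z hz
  ext w
  refine congrArg (fun v => t'.Q (B'.triv t'.i (φ z) v)) ?_
  exact ((hT₀ z (t.trivInv z w)).trans (congrArg _ (t.coe_trivInv hz w))).symm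

theorem isMorphismToDual_of_apply_eq {T : ∀ x, F x →L[ℝ] G x →L[ℝ] ℝ}
    (hT : B.IsMorphismToDual B' T) {T₀ : ∀ y, S y →L[ℝ] S' y →L[ℝ] ℝ}
    (hT₀ : ∀ y v w, T₀ y v w = T (φ y) v w) :
    (hS.bundle hk hα hl hφ).IsMorphismToDual (hS'.bundle hk hα hl hφ) T₀ := by
  intro a b y ha hb
  let t := hS.localTriv a
  let t' := hS'.localTriv b
  have h := (hT t.i t'.i (φ y) (t.maps_baseSet y ha) (t'.maps_baseSet y hb)).comp_isRegularMap
    hα hk hl hφ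
  refine ((((t'.regAt_R y hb).precomp hα).clm_comp hα h).clm_comp hα (t.regAt_R y ha)).congr ?_
  filter_upwards [t.eventually_mem_baseSet ha, t'.eventually_mem_baseSet hb] with z hz hz'
  ext w w'
  change T (φ z) (B.trivInv _ _ (t.R z w)) (B'.trivInv _ _ (t'.R z w')) =
    T₀ z (t.trivInv z w) (t'.trivInv z w')
  rw [hT₀, t.coe_trivInv hz, t'.coe_trivInv hz']

end IsSubbundle

end Subbundle

/-! ### Kernels of bundle morphisms -/

/-- A right inverse of `T y₀` and the projection `Q` along its range give the isomorphism
`(T y₀, Q)`. The nearby operators `(T y, Q)` are still invertible, and the restriction of their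
inverses to the second factor parametrizes the kernels of the `T y`. -/
theorem BanachManifold.RegAt.exists_ker_parametrization {M : Type*} [TopologicalSpace M]
    {k l : ℕ∞} {α : ℝ≥0} (hα : α ≤ 1) {𝔐 : BanachManifold M k α} {V W : Type*}
    [NormedAddCommGroup V] [NormedSpace ℝ V] [CompleteSpace V]
    [NormedAddCommGroup W] [NormedSpace ℝ W] {T : M → V →L[ℝ] W} {s : Set M} (hs : IsOpen s)
    (hT : ∀ y ∈ s, 𝔐.RegAt l T y) {y₀ : M} (hy₀ : y₀ ∈ s) {b : W →L[ℝ] V}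
    (hb : Function.RightInverse b (T y₀)) :
    ∃ t ⊆ s, IsOpen t ∧ y₀ ∈ t ∧ ∃ (Q : V →L[ℝ] (T y₀).ker) (R : M → (T y₀).ker →L[ℝ] V),
      ∀ y ∈ t, 𝔐.RegAt l R y ∧ (∀ w, T y (R y w) = 0) ∧ (∀ w, Q (R y w) = w) ∧
        ∀ v, T y v = 0 → R y (Q v) = v := by
  let Q := (T y₀).projKerOfRightInverse b hb
  let e (y : M) : V →L[ℝ] W × (T y₀).ker := (T y).prod Q
  have he₀ : (e y₀).IsInvertible := ⟨.equivOfRightInverse (T y₀) b hb, rfl⟩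
  have he (y) (hy : y ∈ s) : 𝔐.RegAt l e y := (hT y hy).clm_prod hα (.const hα Q)
  obtain ⟨t, ht, hto, hyt⟩ := eventually_nhds_iff.1
    ((hs.eventually_mem hy₀).and (eventually_isInvertible (he y₀ hy₀).continuousAt he₀))
  have hsplit (y) (hy : y ∈ t) (w) : e y ((e y).inverse (0, w)) = (0, w) :=
    (ht y hy).2.self_apply_inverse _
  refine ⟨t, fun y hy => (ht y hy).1, hto, hyt, Q, fun y => (e y).inverse.comp (.inr ℝ W _),
    fun y hy => ⟨?_, fun w => congrArg Prod.fst (hsplit y hy w),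
      fun w => congrArg Prod.snd (hsplit y hy w), fun v hv => ?_⟩⟩
  · exact ((he y (ht y hy).1).inverse hα (ht y hy).2).clm_comp hα (.const hα _)
  · have hev : e y v = (0, Q v) := Prod.ext hv rfl
    change (e y).inverse (0, Q v) = v
    rw [← hev, (ht y hy).2.inverse_apply_self]

theorem BanachBundle.IsMorphismOver.isSubbundle_ker {M₀ M : Type u} [TopologicalSpace M₀]
    [TopologicalSpace M] {N : Type v} [TopologicalSpace N] {k l : ℕ∞} {α : ℝ≥0}
    {𝔐₀ : BanachManifold M₀ k α} {𝔐 : BanachManifold M k α} {𝔑 : BanachManifold N k α}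
    {F : M → Type u} [∀ x, AddCommGroup (F x)] [∀ x, Module ℝ (F x)] [∀ x, TopologicalSpace (F x)]
    {K : N → Type v} [∀ x, AddCommGroup (K x)] [∀ x, Module ℝ (K x)] [∀ x, TopologicalSpace (K x)]
    {B : BanachBundle 𝔐 l F} {B' : BanachBundle 𝔑 l K} {Φ : M → N} {φ : M₀ → M} (hk : 1 ≤ k)
    (hα : α ≤ 1) (hl : l ≤ k) (hΦ : Continuous Φ) (hφ : 𝔐₀.IsRegularMap 𝔐 φ)
    {a : ∀ x, F x →L[ℝ] K (Φ x)} (ha : B.IsMorphismOver B' Φ a)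
    (b : ∀ y, K (Φ (φ y)) →L[ℝ] F (φ y)) (hb : ∀ y, Function.RightInverse (b y) (a (φ y))) :
    IsSubbundle 𝔐₀ B φ fun y => LinearMap.ker (a (φ y)).toLinearMap := by
  intro y₀
  obtain ⟨i, hi⟩ := B.cover (φ y₀)
  obtain ⟨j, hj⟩ := B'.cover (Φ (φ y₀))
  let s := φ ⁻¹' (B.baseSet i ∩ Φ ⁻¹' B'.baseSet j)
  have hs : IsOpen s :=
    ((B.isOpen_baseSet i).inter ((B'.isOpen_baseSet j).preimage hΦ)).preimage hφ.1
  let T (x : M) := ((B'.triv j (Φ x)).comp (a x)).comp (B.trivInv i x)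
  have hT (y) (hy : y ∈ s) : 𝔐₀.RegAt l (fun y => T (φ y)) y :=
    (ha i j (φ y) hy.1 hy.2).comp_isRegularMap hα hk hl hφ
  have hb₀ : Function.RightInverse ((B.triv i (φ y₀)).comp ((b y₀).comp
      (B'.trivInv j (Φ (φ y₀))))) (T (φ y₀)) := fun w => by
    change B'.triv j _ (a (φ y₀) (B.trivInv i _ (B.triv i _ (b y₀ (B'.trivInv j _ w))))) = w
    rw [B.left_inv i _ hi, hb y₀, B'.right_inv j _ hj]
  obtain ⟨t, hts, hto, hyt, Q, R, hQR⟩ := BanachManifold.RegAt.exists_ker_parametrization hα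
    (T := fun y => T (φ y)) hs hT ⟨hi, hj⟩ hb₀
  have hker (y) (hy : y ∈ t) (w) : T (φ y) w = 0 ↔ a (φ y) (B.trivInv i (φ y) w) = 0 :=
    B'.triv_eq_zero_iff (hts hy).2
  exact ⟨{
    i := i
    W := (T (φ y₀)).ker
    complete := (T (φ y₀)).isClosed_ker.completeSpace_coe
    baseSet := t
    isOpen_baseSet := hto
    maps_baseSet := fun y hy => (hts hy).1
    Q := Q
    R := R
    regAt_R := fun y hy => (hQR y hy).1
    R_mem := fun y hy w => (hker y hy _).1 ((hQR y hy).2.1 w)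
    Q_R := fun y hy => (hQR y hy).2.2.1
    R_Q := fun y hy v hv => (hQR y hy).2.2.2 _ <| (hker y hy _).2 <| by
      rwa [B.left_inv i _ (hts hy).1] }, hyt⟩

/-! ### Level sets of morphisms of para-Riemannian manifolds -/

open BanachManifold in
theorem BanachBundle.IsMorphismToTangent.levelSet {M : Type u} [TopologicalSpace M] {N : Type v}
    [TopologicalSpace N] {k : ℕ∞} {α : ℝ≥0} (hk : 1 ≤ k) (hα : α ≤ 1) {𝔐 : BanachManifold M k α}
    {𝔑 : BanachManifold N k α} {Φ : M → N} {y₀ : N}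
    {h : ∀ x, Φ x = y₀ → 𝔐.IsSubmersionAt 𝔑 Φ x}
    {F : M → Type u} [∀ x, AddCommGroup (F x)] [∀ x, Module ℝ (F x)] [∀ x, TopologicalSpace (F x)]
    {S : {x // Φ x = y₀} → Type u} [∀ x, AddCommGroup (S x)] [∀ x, Module ℝ (S x)]
    [∀ x, TopologicalSpace (S x)] {B : BanachBundle 𝔐 (k - 1) F}
    {B₀ : BanachBundle (levelSet hk hα h) (k - 1) S} {τ : ∀ x, F x →L[ℝ] 𝔐.TangentSpace x}
    {τ₀ : ∀ x, S x →L[ℝ] (levelSet hk hα h).TangentSpace x} {L : ∀ x, S x →L[ℝ] F x.1}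
    (hτ : B.IsMorphismToTangent τ) (hL : B₀.IsMorphismOver B Subtype.val L)
    (hτ₀ : ∀ x v, (BanachManifold.levelSet hk hα h).IsTangentImage 𝔐 Subtype.val x (τ₀ x v)
      (τ x (L x v))) :
    B₀.IsMorphismToTangent τ₀ := by
  intro i a x hi ha
  let c := (h a.1 a.2).chart
  obtain ⟨j, hj⟩ := B.cover x.1
  have hsnd : ∀ᶠ y in 𝓝 x.1, 𝔐.RegAt k (fun y => (c.ψ y).2) y := by
    filter_upwards [c.ψ.open_source.mem_nhds ha] with y hy using c.regAt_snd hα hy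
  have hreg := (hτ.regAt_differential_comp hk hα hsnd hj).comp_isRegularMap hα hk tsub_le_self
    (isRegularMap_levelSet_val hk hα h)
  refine (hreg.clm_comp hα (hL i j x hi hj)).congr ?_
  filter_upwards [((B.isOpen_baseSet j).preimage continuous_subtype_val).mem_nhds hj,
    ((BanachManifold.levelSet hk hα h).chart a).open_source.mem_nhds ha] with y hyj hya
  ext w
  change 𝔐.differential _ y.1 (τ y (B.trivInv j y (B.triv j y (L y (B₀.trivInv i y w))))) =
    (BanachManifold.levelSet hk hα h).dchart a y (τ₀ y (B₀.trivInv i y w))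
  rw [B.left_inv j y hyj, ← differential_chart hk hya,
    differential_levelSet_chart hk hα h hya (hτ₀ y _)]

section LevelSet

variable {M₁ : Type u} [TopologicalSpace M₁] {M₂ : Type v} [TopologicalSpace M₂]
  {k : ℕ∞} {α : ℝ≥0} {X₁ H₁ Y₁ : M₁ → Type u} {X₂ H₂ Y₂ : M₂ → Type v}
  [∀ x, AddCommGroup (X₁ x)] [∀ x, Module ℝ (X₁ x)] [∀ x, TopologicalSpace (X₁ x)]
  [∀ x, AddCommGroup (H₁ x)] [∀ x, Module ℝ (H₁ x)] [∀ x, TopologicalSpace (H₁ x)]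
  [∀ x, AddCommGroup (Y₁ x)] [∀ x, Module ℝ (Y₁ x)] [∀ x, TopologicalSpace (Y₁ x)]
  [∀ x, AddCommGroup (X₂ x)] [∀ x, Module ℝ (X₂ x)] [∀ x, TopologicalSpace (X₂ x)]
  [∀ x, AddCommGroup (H₂ x)] [∀ x, Module ℝ (H₂ x)] [∀ x, TopologicalSpace (H₂ x)]
  [∀ x, AddCommGroup (Y₂ x)] [∀ x, Module ℝ (Y₂ x)] [∀ x, TopologicalSpace (Y₂ x)]

namespace ParaRiemannianManifold

variable (P : ParaRiemannianManifold M₁ k α X₁ H₁ Y₁)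

/-- A regular chart of the manifold, composed with `τ`: the bundle `X` at `x` read in the chart. -/
noncomputable def chartEquiv (hk : 1 ≤ k) (hα : α ≤ 1) {V : Type*} [NormedAddCommGroup V]
    [NormedSpace ℝ V] {ψ : OpenPartialHomeomorph M₁ V} (hψ : P.mfd.IsRegularChart ψ) {x : M₁}
    (hx : x ∈ ψ.source) : X₁ x ≃L[ℝ] V :=
  (P.τ x).trans (hψ.differentialEquiv hk hα hx)

end ParaRiemannianManifold

namespace ParaRiemannianMor

variable {P₁ : ParaRiemannianManifold M₁ k α X₁ H₁ Y₁}
  {P₂ : ParaRiemannianManifold M₂ k α X₂ H₂ Y₂} {Φ : M₁ → M₂} (A : ParaRiemannianMor P₁ P₂ Φ)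
  {y₀ : M₂}

/-- The fibre morphisms of `A` over the level set of `y₀` are surjective and have pseudoinverses. -/
def IsRegularValue (y₀ : M₂) : Prop :=
  ∀ x, Φ x = y₀ → (A.mor x).IsSurjective ∧ ∃ B, (A.mor x).IsPseudoinverse B

theorem isSubmersionAt (hk : 1 ≤ k) (hα : α ≤ 1) {x : M₁} {R : X₂ (Φ x) →L[ℝ] X₁ x}
    (hR : Function.RightInverse R (A.mor x).X) : P₁.mfd.IsSubmersionAt P₂.mfd Φ x := by
  obtain ⟨d, hd⟩ := P₂.mfd.cover (Φ x)
  let e := P₂.chartEquiv hk hα (BanachManifold.isRegularChart_chart d) hd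
  have he (u : X₂ (Φ x)) : e u = P₂.mfd.dchart d (Φ x) (P₂.τ (Φ x) u) :=
    DFunLike.congr_fun (BanachManifold.differential_chart hk hd) _
  refine A.regular.isSubmersionAt hk hα hd
    (R := (P₁.τ x : X₁ x →L[ℝ] _).comp (R.comp (e.symm : _ →L[ℝ] X₂ (Φ x)))) fun w => ?_
  change P₁.mfd.differential _ x (P₁.τ x (R (e.symm w))) = w
  rw [(A.regular.isTangentImage_iff hk).1 (A.tangent x _) d hd, hR, ← he, e.apply_symm_apply]

theorem fst_chartEquiv_eq_zero_iff (hk : 1 ≤ k) (hα : α ≤ 1)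
    (c : P₁.mfd.SubmersionChart P₂.mfd Φ) {x : M₁} (hx : x ∈ c.ψ.source) (u : X₁ x) :
    (P₁.chartEquiv hk hα c.isRegularChart hx u).1 = 0 ↔ (A.mor x).X u = 0 := by
  let e := P₂.chartEquiv hk hα (BanachManifold.isRegularChart_chart c.d) (c.maps_source x hx)
  have : (P₁.chartEquiv hk hα c.isRegularChart hx u).1 = e ((A.mor x).X u) :=
    (c.differential_fst hk A.regular hx (A.tangent x u)).trans <| .symm <|
      DFunLike.congr_fun (BanachManifold.differential_chart hk (c.maps_source x hx)) _
  rw [this, e.map_eq_zero_iff]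

namespace IsRegularValue

variable {A}

theorem exists_rightInverse (h : A.IsRegularValue y₀) {x : M₁} (hx : Φ x = y₀) :
    ∃ B : ParaHilbertMor (P₂.E.fib (Φ x)) (P₁.E.fib x), Function.RightInverse B.X (A.mor x).X ∧
      Function.RightInverse B.H (A.mor x).H ∧ Function.RightInverse B.Y (A.mor x).Y :=
  let ⟨hA, B, hB⟩ := h x hx
  ⟨B, hA.rightInverse hB⟩

theorem isSubmersionAt (hk : 1 ≤ k) (hα : α ≤ 1) (h : A.IsRegularValue y₀) (x : M₁)
    (hx : Φ x = y₀) : P₁.mfd.IsSubmersionAt P₂.mfd Φ x :=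
  let ⟨_, hB, _⟩ := h.exists_rightInverse hx
  A.isSubmersionAt hk hα hB

variable (hk : 1 ≤ k) (hα : α ≤ 1) (h : A.IsRegularValue y₀)

/-- The level set as a Banach manifold. -/
noncomputable abbrev levelSetManifold : BanachManifold {x // Φ x = y₀} k α :=
  BanachManifold.levelSet hk hα (h.isSubmersionAt hk hα)

theorem isRegularMap_val : (h.levelSetManifold hk hα).IsRegularMap P₁.mfd Subtype.val :=
  BanachManifold.isRegularMap_levelSet_val hk hα (h.isSubmersionAt hk hα)

/-- The isomorphism of the kernel of `(A.mor x).X` with the tangent space of the level set. -/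
noncomputable def levelSetτ (x : {x // Φ x = y₀}) :
    LinearMap.ker (A.mor x.1).X.toLinearMap ≃L[ℝ] (h.levelSetManifold hk hα).TangentSpace x :=
  let hx := h.isSubmersionAt hk hα x x.2
  (kerEquivOfEquivProd (A.mor x.1).X
      (P₁.chartEquiv hk hα hx.chart.isRegularChart hx.mem_source)
      fun u => (A.fst_chartEquiv_eq_zero_iff hk hα hx.chart hx.mem_source u).symm).trans
    (BanachManifold.levelSetTangentEquiv hk hα (h.isSubmersionAt hk hα) x).symm

theorem isTangentImage_levelSetτ (x : {x // Φ x = y₀})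
    (u : LinearMap.ker (A.mor x.1).X.toLinearMap) :
    (h.levelSetManifold hk hα).IsTangentImage P₁.mfd Subtype.val x (h.levelSetτ hk hα x u)
      (P₁.τ x u) := by
  have hx := h.isSubmersionAt hk hα x x.2
  refine BanachManifold.isTangentImage_levelSet_val hk hα (h.isSubmersionAt hk hα) ?_
  refine Prod.ext ((A.fst_chartEquiv_eq_zero_iff hk hα hx.chart hx.mem_source u).2 u.2) ?_
  exact (ContinuousLinearEquiv.apply_symm_apply _ _).symm

theorem isSubbundle_ker_X : IsSubbundle (h.levelSetManifold hk hα) P₁.E.bX Subtype.val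
    fun x => LinearMap.ker (A.mor x.1).X.toLinearMap :=
  A.regular_X.isSubbundle_ker hk hα tsub_le_self A.regular.1 (h.isRegularMap_val hk hα)
    (fun x => (h.exists_rightInverse x.2).choose.X)
    fun x => (h.exists_rightInverse x.2).choose_spec.1

theorem isSubbundle_ker_H : IsSubbundle (h.levelSetManifold hk hα) P₁.E.bH Subtype.val
    fun x => LinearMap.ker (A.mor x.1).H.toLinearMap :=
  A.regular_H.isSubbundle_ker hk hα tsub_le_self A.regular.1 (h.isRegularMap_val hk hα)
    (fun x => (h.exists_rightInverse x.2).choose.H)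
    fun x => (h.exists_rightInverse x.2).choose_spec.2.1

theorem isSubbundle_ker_Y : IsSubbundle (h.levelSetManifold hk hα) P₁.E.bY Subtype.val
    fun x => LinearMap.ker (A.mor x.1).Y.toLinearMap :=
  A.regular_Y.isSubbundle_ker hk hα tsub_le_self A.regular.1 (h.isRegularMap_val hk hα)
    (fun x => (h.exists_rightInverse x.2).choose.Y)
    fun x => (h.exists_rightInverse x.2).choose_spec.2.2

/-- The kernel of `A` over the level set, with the restrictions of `I` and `J`. -/
noncomputable def kerBundle : ParaHilbertBundle (h.levelSetManifold hk hα) (k - 1)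
    (fun x => LinearMap.ker (A.mor x.1).X.toLinearMap)
    (fun x => LinearMap.ker (A.mor x.1).H.toLinearMap)
    (fun x => LinearMap.ker (A.mor x.1).Y.toLinearMap) :=
  have := P₁.E.bX.isTopologicalAddGroup
  have := P₁.E.bH.isTopologicalAddGroup
  have := P₁.E.bY.isTopologicalAddGroup
  let hl : k - 1 ≤ k := tsub_le_self
  let hφ := h.isRegularMap_val hk hα
  let hX := h.isSubbundle_ker_X hk hα
  let hH := h.isSubbundle_ker_H hk hα
  let hY := h.isSubbundle_ker_Y hk hα
  { bX := hX.bundle hk hα hl hφ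
    bH := hH.bundle hk hα hl hφ
    bY := hY.bundle hk hα hl hφ
    fib := fun x => (A.mor x.1).ker (h x.1 x.2).2
    regular_i := hX.isMorphism_of_coe_eq hk hα hl hφ hH P₁.E.regular_i fun _ _ => rfl
    regular_j := hH.isMorphism_of_coe_eq hk hα hl hφ hY P₁.E.regular_j fun _ _ => rfl
    regular_I := hH.isMorphismToDual_of_apply_eq hk hα hl hφ hH P₁.E.regular_I fun _ _ _ => rfl
    regular_J := hX.isMorphismToDual_of_apply_eq hk hα hl hφ hY P₁.E.regular_J fun _ _ _ => rfl }

/-- The level set with the kernel of `A` as a para-Riemannian manifold. -/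
noncomputable def levelSet : ParaRiemannianManifold {x // Φ x = y₀} k α
    (fun x => LinearMap.ker (A.mor x.1).X.toLinearMap)
    (fun x => LinearMap.ker (A.mor x.1).H.toLinearMap)
    (fun x => LinearMap.ker (A.mor x.1).Y.toLinearMap) where
  mfd := h.levelSetManifold hk hα
  E := h.kerBundle hk hα
  τ := h.levelSetτ hk hα
  regular_τ := P₁.regular_τ.levelSet hk hα
    ((h.isSubbundle_ker_X hk hα).isMorphismOver_subtypeL hk hα tsub_le_self
      (h.isRegularMap_val hk hα))
    (h.isTangentImage_levelSetτ hk hα)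

/-- The inclusion of the level set. -/
noncomputable def levelSetInclusion : ParaRiemannianMor (h.levelSet hk hα) P₁ Subtype.val where
  regular := h.isRegularMap_val hk hα
  mor _ := {
    X := Submodule.subtypeL _
    H := Submodule.subtypeL _
    Y := Submodule.subtypeL _
    comm_i := fun _ => rfl
    comm_j := fun _ => rfl }
  regular_X := (h.isSubbundle_ker_X hk hα).isMorphismOver_subtypeL hk hα tsub_le_self
    (h.isRegularMap_val hk hα)
  regular_H := (h.isSubbundle_ker_H hk hα).isMorphismOver_subtypeL hk hα tsub_le_self
    (h.isRegularMap_val hk hα)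
  regular_Y := (h.isSubbundle_ker_Y hk hα).isMorphismOver_subtypeL hk hα tsub_le_self
    (h.isRegularMap_val hk hα)
  tangent := h.isTangentImage_levelSetτ hk hα

end IsRegularValue

end ParaRiemannianMor

end LevelSet

theorem mainTheorem5 {M₁ : Type u} [TopologicalSpace M₁] {M₂ : Type v} [TopologicalSpace M₂]
    {X₁ H₁ Y₁ : M₁ → Type u} {X₂ H₂ Y₂ : M₂ → Type v}
    [∀ x, AddCommGroup (X₁ x)] [∀ x, Module ℝ (X₁ x)] [∀ x, TopologicalSpace (X₁ x)]
    [∀ x, AddCommGroup (H₁ x)] [∀ x, Module ℝ (H₁ x)] [∀ x, TopologicalSpace (H₁ x)]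
    [∀ x, AddCommGroup (Y₁ x)] [∀ x, Module ℝ (Y₁ x)] [∀ x, TopologicalSpace (Y₁ x)]
    [∀ x, AddCommGroup (X₂ x)] [∀ x, Module ℝ (X₂ x)] [∀ x, TopologicalSpace (X₂ x)]
    [∀ x, AddCommGroup (H₂ x)] [∀ x, Module ℝ (H₂ x)] [∀ x, TopologicalSpace (H₂ x)]
    [∀ x, AddCommGroup (Y₂ x)] [∀ x, Module ℝ (Y₂ x)] [∀ x, TopologicalSpace (Y₂ x)]
    (k : ℕ∞) (hk : 1 ≤ k) (α : ℝ≥0) (hα : α ≤ 1)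
    (P₁ : ParaRiemannianManifold M₁ k α X₁ H₁ Y₁) (P₂ : ParaRiemannianManifold M₂ k α X₂ H₂ Y₂)
    (Φ : M₁ → M₂) (A : ParaRiemannianMor P₁ P₂ Φ) (y₀ : M₂)
    (hsurj : ∀ x, Φ x = y₀ → (A.mor x).IsSurjective)
    (hpinv : ∀ x, Φ x = y₀ → ∃ B, (A.mor x).IsPseudoinverse B) :
    ∃ P₀ : ParaRiemannianManifold {x : M₁ // Φ x = y₀} k α
        (fun x => LinearMap.ker (A.mor x.1).X.toLinearMap)
        (fun x => LinearMap.ker (A.mor x.1).H.toLinearMap)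
        (fun x => LinearMap.ker (A.mor x.1).Y.toLinearMap),
      (∀ x v₁ v₂, (P₀.E.fib x).I v₁ v₂ = (P₁.E.fib x.1).I v₁.1 v₂.1) ∧
      (∀ x u w, (P₀.E.fib x).J u w = (P₁.E.fib x.1).J u.1 w.1) ∧
      ∃ C : ParaRiemannianMor P₀ P₁ Subtype.val, ∀ x,
        (C.mor x).X = (LinearMap.ker (A.mor x.1).X.toLinearMap).subtypeL ∧
        (C.mor x).H = (LinearMap.ker (A.mor x.1).H.toLinearMap).subtypeL ∧
        (C.mor x).Y = (LinearMap.ker (A.mor x.1).Y.toLinearMap).subtypeL := by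
  have h : A.IsRegularValue y₀ := fun x hx => ⟨hsurj x hx, hpinv x hx⟩
  exact ⟨h.levelSet hk hα, fun _ _ _ => rfl, fun _ _ _ => rfl, h.levelSetInclusion hk hα,
    fun _ => ⟨rfl, rfl, rfl⟩⟩
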